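/- Let $n\ge 1$, let $\Omega\subset\mathbb R^n$ be a bounded open set (no regularity of $\partial\Omega$ is needed; in particular $\Omega$ may be of class $\mathcal C^2$), and let $k\in\mathbb R$ be such that $k^2$ is not an eigenvalue of the Dirichlet Laplacian $-\Delta$ on $\Omega$, i.e. the only $u\in H^1_0(\Omega)$ with $\int_\Omega\nabla u\cdot\nabla v\,dx=k^2\int_\Omega uv\,dx$ for all $v\in H_0^1(\Omega)$ is $u=0$. Let $f\in L^2(\Omega)$ be continuous on $\Omega$, let $\eta_0\in L^2(\Omega)$, $A\in L^2(\Omega;\mathbb R^n)$ and $\gamma\in(0,\infty)$. Let $\eta\in H^1_0(\Omega)$ satisfy $$\int_\Omega\nabla\eta\cdot\nabla v\,dx-\int_\Omega k^2\eta v\,dx=\int_\Omega fv\,dx\qquad\forall v\in H^1_0(\Omega),$$ and let the adjoint state $p\in H^1_0(\Omega)$ satisfy $$\int_\Omega\nabla v\cdot\nabla p\,dx-\int_\Omega k^2vp\,dx=-2\int_\Omega(\nabla\eta-A)\cdot\nabla v\,dx-2\int_\Omega(\eta-\eta_0)v\,dx\qquad\forall v\in H^1_0(\Omega).$$ For $u\in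 H_0^1(\Omega)$ put $J(u)=\int_\Omega|\nabla u-A|^2dx+\int_\Omega|u-\eta_0|^2dx$. Fix a pointwise defined representative of $p$, and call $x_0\in\Omega$ a Lebesgue point of $p$ if the mean of $|p-p(x_0)|$ over the ball $B(x_0,r)$ tends to $0$ as $r\to0^+$ (for instance, if $p$ is continuous at $x_0$). Then almost every $x_0\in\Omega$ is a Lebesgue point of $p$. Moreover, for every Lebesgue point $x_0\in\Omega$ of $p$ the following holds. With $\omega_\epsilon=B(x_0,\epsilon)$, let $f_\epsilon=\gamma f$ on $\omega_\epsilon$ and $f_\epsilon=f$ on $\Omega\setminus\omega_\epsilon$, and for all sufficiently small $\epsilon>0$ let $\eta_\epsilon\in H^1_0(\Omega)$ satisfy $$\int_\Omega\nabla\eta_\epsilon\cdot\nabla v\,dx-\int_\Omega k^2\eta_\epsilon v\,dx=\int_\Omega f_\epsilon v\,dx\qquad\forall v\in H^1_0(\Omega).$$ Then the functional has at $x_0$ the topological derivative $$D_TJ(x_0)=(1-\gamma)f(x_0)p(x_0)$$ with respect to the volume $|\omega_\epsilon|$ (which is $\pi\epsilon^2$ for $n=2$), i.e. $|\omega_\epsilon|>0$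 for all small $\epsilon>0$, $|\omega_\epsilon|\to0$, and $$J(\eta_\epsilon)=J(\eta)+|\omega_\epsilon|\,(1-\gamma)f(x_0)p(x_0)+o(|\omega_\epsilon|)\qquad(\epsilon\to0^+).$$ -/

import Mathlib

open MeasureTheory Filter Topology Metric
open scoped ENNReal ContDiff Gradient

namespace HelmholtzTopDeriv

/-- Euclidean space `ℝⁿ`. -/
abbrev E (n : ℕ) : Type := EuclideanSpace ℝ (Fin n)

/-- Lebesgue measure on `Ω`. -/
noncomputable abbrev vol {n : ℕ} (Ω : Set (E n)) : Measure (E n) := volume.restrict Ω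

/-- `φ ∈ C_c^∞(Ω)`. -/
structure IsTestFunction {n : ℕ} (Ω : Set (E n)) (φ : E n → ℝ) : Prop where
  smooth : ContDiff ℝ ∞ φ
  compact : HasCompactSupport φ
  support : tsupport φ ⊆ Ω

/-- `g ∈ L²(Ω; ℝⁿ)` is a weak gradient of `u` on `Ω`:
`∫_Ω u ∇φ = -∫_Ω φ g` for all `φ ∈ C_c^∞(Ω)`. -/
def IsWeakGradient {n : ℕ} (Ω : Set (E n)) (u : E n → ℝ) (g : E n → E n) : Prop :=
  MemLp g 2 (vol Ω) ∧ ∀ φ : E n → ℝ, IsTestFunction Ω φ →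
    ∫ x in Ω, u x • ∇ φ x = -∫ x in Ω, φ x • g x

/-- `u ∈ H¹(Ω)`: `u` is square integrable with a square integrable weak gradient. -/
def MemH1 {n : ℕ} (Ω : Set (E n)) (u : E n → ℝ) : Prop :=
  MemLp u 2 (vol Ω) ∧ ∃ g, IsWeakGradient Ω u g

open Classical in
/-- The weak gradient of `u ∈ H¹(Ω)`; it is determined almost everywhere on `Ω`
(and set to `0` if there is none). -/
noncomputable def weakGrad {n : ℕ} (Ω : Set (E n)) (u : E n → ℝ) : E n → E n :=
  if h : ∃ g, IsWeakGradient Ω u g then h.choose else 0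

/-- `u ∈ H¹₀(Ω)`, the closure of `C_c^∞(Ω)` in `H¹(Ω)`. -/
def MemH10 {n : ℕ} (Ω : Set (E n)) (u : E n → ℝ) : Prop :=
  MemH1 Ω u ∧ ∃ φ : ℕ → E n → ℝ, (∀ m, IsTestFunction Ω (φ m)) ∧
    Tendsto (fun m => eLpNorm (fun x => φ m x - u x) 2 (vol Ω)) atTop (𝓝 0) ∧
    Tendsto (fun m => eLpNorm (fun x => ∇ (φ m) x - weakGrad Ω u x) 2 (vol Ω)) atTop (𝓝 0)

/-- The bilinear form `∫_Ω ∇u·∇v dx - ∫_Ω k² u v dx`. -/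
noncomputable def helmholtzForm {n : ℕ} (Ω : Set (E n)) (k : ℝ) (u v : E n → ℝ) : ℝ :=
  (∫ x in Ω, inner ℝ (weakGrad Ω u x) (weakGrad Ω v x)) - ∫ x in Ω, k ^ 2 * (u x * v x)

/-- `u ∈ H¹₀(Ω)` is the variational solution of `-Δu - k²u = f` in `Ω`, `u = 0` on `∂Ω`. -/
def IsHelmholtzSolution {n : ℕ} (Ω : Set (E n)) (k : ℝ) (f u : E n → ℝ) : Prop :=
  MemH10 Ω u ∧ ∀ v, MemH10 Ω v → helmholtzForm Ω k u v = ∫ x in Ω, f x * v x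

/-- `μ` is an eigenvalue of the Dirichlet Laplacian `-Δ` on `Ω`: the problem `-Δu - μu = 0`,
`u = 0` on `∂Ω`, has a weak solution that is not zero. -/
def IsDirichletEigenvalue {n : ℕ} (Ω : Set (E n)) (μ : ℝ) : Prop :=
  ∃ u, MemH10 Ω u ∧ ¬ (u =ᵐ[vol Ω] 0) ∧ ∀ v, MemH10 Ω v →
    ∫ x in Ω, inner ℝ (weakGrad Ω u x) (weakGrad Ω v x) = ∫ x in Ω, μ * (u x * v x)

/-- The tracking functional `∫_Ω |∇u - A|² dx + ∫_Ω |u - η₀|² dx`. -/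
noncomputable def trackingFunctional {n : ℕ} (Ω : Set (E n)) (A : E n → E n) (η₀ u : E n → ℝ) :
    ℝ :=
  (∫ x in Ω, ‖weakGrad Ω u x - A x‖ ^ 2) + ∫ x in Ω, |u x - η₀ x| ^ 2

/-- `p ∈ H¹₀(Ω)` is the adjoint state associated with the state `u`. -/
def IsAdjointState {n : ℕ} (Ω : Set (E n)) (k : ℝ) (A : E n → E n) (η₀ u p : E n → ℝ) : Prop :=
  MemH10 Ω p ∧ ∀ v, MemH10 Ω v →
    helmholtzForm Ω k v p =
      -2 * (∫ x in Ω, inner ℝ (weakGrad Ω u x - A x) (weakGrad Ω v x))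
        - 2 * ∫ x in Ω, (u x - η₀ x) * v x

open Classical in
/-- The perturbed source: `γ f` on the ball `B(x₀, ε)` and `f` elsewhere. -/
noncomputable def perturbedSource {n : ℕ} (f : E n → ℝ) (γ : ℝ) (x₀ : E n) (ε : ℝ) : E n → ℝ :=
  fun x => if x ∈ ball x₀ ε then γ * f x else f x

/-- `x₀` is a Lebesgue point of `p`, with value `p x₀`:
the mean of `|p - p(x₀)|` over `B(x₀, r)` tends to `0` as `r → 0⁺`. -/
def IsLebesguePoint {n : ℕ} (p : E n → ℝ) (x₀ : E n) : Prop :=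
  Tendsto (fun r : ℝ => ⨍ y in ball x₀ r, |p y - p x₀|) (𝓝[>] 0) (𝓝 0)

/-- `D` is the topological derivative of the perturbed functional `ψ` (with unperturbed value
`ψ₀`) relative to the scale `s`, a positive function tending to `0`:
`ψ(ε) = ψ₀ + s(ε) D + o(s(ε))` as `ε → 0⁺`. -/
def HasTopologicalDerivative (ψ : ℝ → ℝ) (ψ₀ : ℝ) (s : ℝ → ℝ) (D : ℝ) : Prop :=
  (∀ᶠ ε in 𝓝[>] 0, 0 < s ε) ∧ Tendsto s (𝓝[>] 0) (𝓝 0) ∧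
    (fun ε => ψ ε - ψ₀ - s ε * D) =o[𝓝[>] 0] s

end HelmholtzTopDeriv

/-! Send `u` to the pair `(u, ∇u)` in `L² × L²`. The functional becomes a squared Hilbert distance,
so its expansion around the state is exact: a first-order term plus the squared `H¹` norm of the
state increment. The adjoint equation turns the first-order term into `(1 - γ) ∫ f p` over the ball.
At a Lebesgue point of `p`, continuity of `f` makes this the announced main term up to `o(|ω|)`.

It remains to show that the squared norm of the increment is `o(|ω|)`. The plain energy estimate
gives only `O(|ω|)`, because the source perturbation has `L²` norm of order `√|ω|`. The gain comes
from compactness. Divided by `√|ω|`, the perturbations are bounded and weakly null in `L²`, since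
they concentrate on a shrinking ball. The embedding `ι` of `H¹₀` in `L²` is compact, so `ι*` makes
them strongly null. The Fredholm alternative away from the Dirichlet spectrum bounds the increment
by the norm of `ι*` applied to the perturbation. No regularity of the boundary or of the solutions
enters.

The main lemmas are `isCompactOperator_embL2` (Rellich), `exists_norm_le_adjoint_embL2` (stability),
`adjoint_sourceIncrement_sq_isLittleO` and `trackingFunctional_sub_eq`. -/

namespace HelmholtzTopDeriv

/-! ### Compact operators between Hilbert spaces and stability of variational problems. -/

section Abstract

variable {H L : Type*} [NormedAddCommGroup H] [InnerProductSpace ℝ H]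
  [NormedAddCommGroup L] [InnerProductSpace ℝ L] [CompleteSpace L]

/-- An operator that is controlled, up to an arbitrarily small multiple of the norm, by operators
into finite-dimensional spaces is compact. -/
theorem isCompactOperator_of_forall_norm_sq_le (ι : H →L[ℝ] L)
    (h : ∀ δ > 0, ∃ (m : ℕ) (R : H →L[ℝ] EuclideanSpace ℝ (Fin m)),
      ∀ u, ‖ι u‖ ^ 2 ≤ δ * ‖u‖ ^ 2 + ‖R u‖ ^ 2) : IsCompactOperator ι := by
  have key : TotallyBounded (ι '' closedBall 0 1) := by
    rw [Metric.totallyBounded_iff]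
    intro ε hε
    -- Two points of the unit ball differ by at most 2, so this term costs at most `ε ^ 2 / 2`; the
    -- net for `R` at scale `ε / 2` costs at most `ε ^ 2 / 4`.
    obtain ⟨m, R, hR⟩ := h (ε ^ 2 / 8) (by positivity)
    have hb : TotallyBounded (R '' closedBall 0 1) :=
      (R.lipschitz.isBounded_image isBounded_closedBall).isCompact_closure.totallyBounded.subset
        subset_closure
    obtain ⟨s, hs, hsf, ht⟩ := Set.exists_subset_image_finite_and.1
      (Metric.finite_approx_of_totallyBounded hb _ (half_pos hε))
    refine ⟨ι '' s, hsf.image _, ?_⟩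
    rintro _ ⟨u, hu, rfl⟩
    obtain ⟨_, ⟨v, hv, rfl⟩, hd⟩ := Set.mem_iUnion₂.1 (ht ⟨u, hu, rfl⟩)
    refine Set.mem_iUnion₂.2 ⟨ι v, ⟨v, hv, rfl⟩, ?_⟩
    have hd' : ‖R (u - v)‖ < ε / 2 := by
      rw [map_sub, ← dist_eq_norm]; exact hd
    have huv : ‖u - v‖ ≤ 2 := by
      have h1 := norm_sub_le u v
      have h2 := mem_closedBall_zero_iff.1 hu
      have h3 := mem_closedBall_zero_iff.1 (hs hv)
      linarith
    have h4 := hR (u - v)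
    rw [mem_ball, dist_eq_norm, ← map_sub]
    have h5 : ‖u - v‖ ^ 2 ≤ 2 ^ 2 := by gcongr
    have h6 : ‖R (u - v)‖ ^ 2 < (ε / 2) ^ 2 := by gcongr
    refine lt_of_pow_lt_pow_left₀ 2 hε.le ?_
    nlinarith [sq_nonneg ε]
  refine (isCompactOperator_iff_image_closedBall_subset_compact (𝕜₁ := ℝ) ι.toLinearMap
    (r := 1) one_pos).2 ⟨closure (ι '' closedBall 0 1), ?_, subset_closure⟩
  exact key.closure.isCompact_of_isClosed isClosed_closure

variable [CompleteSpace H]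

/-- The adjoint of a compact operator maps bounded weakly null families to null families. -/
theorem tendsto_norm_adjoint_of_isCompactOperator {ι : H →L[ℝ] L} (hι : IsCompactOperator ι)
    {α : Type*} {l : Filter α} {F : α → L} {M : ℝ} (hM : ∀ᶠ a in l, ‖F a‖ ≤ M)
    (hF : ∀ y, Tendsto (fun a => inner ℝ (F a) y) l (𝓝 0)) :
    Tendsto (fun a => ‖ι.adjoint (F a)‖) l (𝓝 0) := by
  obtain ⟨K, hK, hsub⟩ := hι.image_closedBall_subset_compact (f := ι.toLinearMap) 1
  rw [Metric.tendsto_nhds]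
  intro ε hε
  set M' := max M 0 + 1
  have hM' : 0 < M' := by positivity
  obtain ⟨t, htf, ht⟩ := Metric.totallyBounded_iff.1 hK.totallyBounded (ε / (4 * M'))
    (by positivity)
  have hev : ∀ᶠ a in l, ∀ y ∈ t, |inner ℝ (F a) y| < ε / 4 := by
    rw [Filter.eventually_all_finite htf]
    intro y _
    have := Metric.tendsto_nhds.1 (hF y) (ε / 4) (by positivity)
    simpa [Real.dist_eq] using this
  filter_upwards [hev, hM] with a ha hMa
  rw [Real.dist_eq, sub_zero, abs_norm]
  refine lt_of_le_of_lt (b := ε / 2) ?_ (by linarith)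
  by_contra! hcon
  -- The norm of `w` is attained by pairing `F a` with the image under `ι` of the unit vector along
  -- `w`. That image lies in `K`, hence near one of the finitely many net points, where the pairing
  -- is already small.
  set w := ι.adjoint (F a)
  have hw : 0 < ‖w‖ := lt_trans (by positivity) hcon
  have hmem : ι (‖w‖⁻¹ • w) ∈ K := hsub ⟨‖w‖⁻¹ • w, by
    simp [norm_smul, hw.ne'], rfl⟩
  obtain ⟨y, hy, hd⟩ := Set.mem_iUnion₂.1 (ht hmem)
  have h1 : inner ℝ (F a) (ι (‖w‖⁻¹ • w)) = ‖w‖ := by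
    rw [← ContinuousLinearMap.adjoint_inner_left, inner_smul_right, real_inner_self_eq_norm_sq]
    change ‖w‖⁻¹ * ‖w‖ ^ 2 = ‖w‖
    field_simp
  have h2 : |inner ℝ (F a) (ι (‖w‖⁻¹ • w) - y)| ≤ M' * (ε / (4 * M')) := by
    refine (abs_real_inner_le_norm _ _).trans ?_
    rw [mem_ball, dist_eq_norm] at hd
    exact mul_le_mul (hMa.trans ((le_max_left M 0).trans (by simp [M']))) hd.le (norm_nonneg _)
      hM'.le
  have h3 : M' * (ε / (4 * M')) = ε / 4 := by field_simp
  rw [inner_sub_right, h1, h3] at h2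
  have h4 := ha y hy
  have h5 := abs_lt.1 h4
  have h6 := abs_le.1 h2
  linarith

/-- A scaled version of `tendsto_norm_adjoint_of_isCompactOperator`. -/
theorem norm_adjoint_sq_isLittleO_of_isCompactOperator {ι : H →L[ℝ] L} (hι : IsCompactOperator ι)
    {α : Type*} {l : Filter α} {F : α → L} {s : α → ℝ} (hs : ∀ᶠ a in l, 0 < s a) {M : ℝ}
    (hM : ∀ᶠ a in l, ‖F a‖ ≤ M * √(s a))
    (hF : ∀ y, Tendsto (fun a => inner ℝ ((√(s a))⁻¹ • F a) y) l (𝓝 0)) :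
    (fun a => ‖ι.adjoint (F a)‖ ^ 2) =o[l] s := by
  have h := tendsto_norm_adjoint_of_isCompactOperator hι (M := M) ?_ hF
  · refine (Asymptotics.isLittleO_iff_tendsto' ?_).2 ?_
    · filter_upwards [hs] with a ha h0
      exact absurd h0 ha.ne'
    · have h2 := h.pow 2
      rw [zero_pow two_ne_zero] at h2
      refine h2.congr' ?_
      filter_upwards [hs] with a ha
      have h3 : 0 ≤ (√(s a))⁻¹ := by positivity
      rw [map_smul, norm_smul_of_nonneg h3, mul_pow, inv_pow, Real.sq_sqrt ha.le, inv_mul_eq_div]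
  · filter_upwards [hM, hs] with a h1 ha
    have hm := Real.sqrt_pos.2 ha
    rw [norm_smul_of_nonneg (inv_nonneg.2 hm.le), inv_mul_le_iff₀ hm, mul_comm]
    exact h1

/-- Stability of the variational problem `⟪u, v⟫ - c ⟪ι u, ι v⟫ = ⟪F, ι v⟫` with `ι` compact,
when the homogeneous problem has only the zero solution. -/
theorem exists_norm_le_adjoint_of_isCompactOperator {ι : H →L[ℝ] L} (hι : IsCompactOperator ι)
    {c : ℝ} (hc : c ≠ 0)
    (h0 : ∀ u, (∀ v, inner ℝ u v = c * inner ℝ (ι u) (ι v)) → u = 0) :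
    ∃ C : ℝ, 0 ≤ C ∧ ∀ (u : H) (F : L),
      (∀ v, inner ℝ u v - c * inner ℝ (ι u) (ι v) = inner ℝ F (ι v)) →
      ‖u‖ ≤ C * ‖ι.adjoint F‖ := by
  set T : H →L[ℝ] H := ι.adjoint ∘L ι with hT
  have hTc : IsCompactOperator T := hι.clm_comp ι.adjoint
  -- An eigenvector of `ι*ι` for `c⁻¹` would solve the homogeneous problem. The Fredholm alternative
  -- then bounds `T - c⁻¹` from below.
  have hev : ¬ Module.End.HasEigenvalue (T : Module.End ℝ H) c⁻¹ := by
    intro h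
    obtain ⟨u, hu⟩ := h.exists_hasEigenvector
    refine hu.2 (h0 u fun v => ?_)
    have h1 : T u = c⁻¹ • u := hu.apply_eq_smul
    rw [← ContinuousLinearMap.adjoint_inner_left]
    change _ = c * inner ℝ (T u) v
    rw [h1, real_inner_smul_left]
    field_simp
  obtain ⟨K, hK⟩ := hTc.antilipschitz_of_not_hasEigenvalue (inv_ne_zero hc) hev
  refine ⟨K * |c|⁻¹, by positivity, fun u F h => ?_⟩
  have h1 : (T - c⁻¹ • (1 : H →L[ℝ] H)) u = -(c⁻¹ • ι.adjoint F) := by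
    refine ext_inner_right ℝ fun v => ?_
    have := h v
    rw [← ContinuousLinearMap.adjoint_inner_left, ← ContinuousLinearMap.adjoint_inner_left ι] at this
    simp only [hT, sub_apply, ContinuousLinearMap.comp_apply,
      smul_apply, one_apply_eq_self, inner_sub_left,
      inner_neg_left, real_inner_smul_left]
    rw [← this]
    field_simp
    ring
  have h2 := hK.le_mul_dist u 0
  rw [map_zero, dist_zero_right, dist_zero_right, h1, norm_neg, norm_smul, norm_inv, Real.norm_eq_abs] at h2
  rwa [mul_assoc]

end Abstract

/-! ### Translation and variance estimates for test functions. -/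

/-- A continuous function on a product that vanishes for second variable outside a compact set
is integrable over compact sets of the first variable. -/
theorem integrable_restrict_prod_of_continuous {X Y : Type*}
    [TopologicalSpace X] [MeasurableSpace X] [OpensMeasurableSpace X] [SecondCountableTopology X]
    [T2Space X]
    [TopologicalSpace Y] [MeasurableSpace Y] [OpensMeasurableSpace Y] [SecondCountableTopology Y]
    [T2Space Y]
    {μ : Measure X} {ν : Measure Y} [IsFiniteMeasureOnCompacts μ] [IsFiniteMeasureOnCompacts ν]
    [SFinite μ] [SFinite ν] {Φ : X × Y → ℝ} (hΦ : Continuous Φ) {B : Set X} {K : Set Y}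
    (hB : IsCompact B) (hK : IsCompact K) (h0 : ∀ a ∈ B, ∀ y, y ∉ K → Φ (a, y) = 0) :
    Integrable Φ ((μ.restrict B).prod ν) := by
  have h1 : (μ.restrict B).prod ν = (μ.prod ν).restrict (B ×ˢ Set.univ) := by
    rw [← Measure.prod_restrict, Measure.restrict_univ]
  rw [h1]
  have h2 : IntegrableOn Φ (B ×ˢ K) (μ.prod ν) := by
    obtain ⟨C, hC⟩ := (hB.prod hK).exists_bound_of_continuousOn hΦ.continuousOn
    refine IntegrableOn.of_bound ?_ hΦ.aestronglyMeasurable C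
      (ae_restrict_of_forall_mem (hB.prod hK).measurableSet hC)
    rw [Measure.prod_prod]
    exact ENNReal.mul_lt_top hB.measure_lt_top hK.measure_lt_top
  refine IntegrableOn.of_forall_sdiff_eq_zero h2 (hB.measurableSet.prod .univ) ?_
  rintro ⟨a, y⟩ ⟨⟨ha, -⟩, hay⟩
  exact h0 a ha y fun hy => hay ⟨ha, hy⟩

section Smooth

variable {n : ℕ}

theorem norm_gradient {φ : E n → ℝ} (x : E n) : ‖∇ φ x‖ = ‖fderiv ℝ φ x‖ := by
  simp [gradient]

theorem continuous_gradient {φ : E n → ℝ} (hφ : ContDiff ℝ ∞ φ) : Continuous (∇ φ) :=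
  (InnerProductSpace.toDual ℝ (E n)).symm.continuous.comp (hφ.continuous_fderiv (by simp))

theorem inner_gradient {φ : E n → ℝ} (x z : E n) : inner ℝ (∇ φ x) z = fderiv ℝ φ x z := by
  simp [gradient]

theorem tsupport_gradient_subset (φ : E n → ℝ) : tsupport (∇ φ) ⊆ tsupport φ := by
  refine (closure_mono fun x hx => ?_).trans (tsupport_fderiv_subset ℝ (f := φ))
  contrapose! hx
  simp only [Function.mem_support, not_not] at hx ⊢
  simp [gradient, hx]

theorem hasCompactSupport_gradient {φ : E n → ℝ} (hφ : HasCompactSupport φ) :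
    HasCompactSupport (∇ φ) :=
  hφ.mono' ((subset_tsupport _).trans (tsupport_gradient_subset φ))

theorem integrable_sq_of_hasCompactSupport {g : E n → ℝ} (hg : Continuous g)
    (hc : HasCompactSupport g) : Integrable fun x => g x ^ 2 := by
  refine (hg.pow 2).integrable_of_hasCompactSupport (hc.mono fun x hx => ?_)
  contrapose! hx
  simp only [Function.mem_support, not_not] at hx ⊢
  simp [hx]

/-- The variance of `g` on an interval of length one is nonnegative. -/
theorem sq_integral_Icc_le {g : ℝ → ℝ} (hg : Continuous g) :
    (∫ t in Set.Icc (0 : ℝ) 1, g t) ^ 2 ≤ ∫ t in Set.Icc (0 : ℝ) 1, g t ^ 2 := by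
  have i1 : IntegrableOn g (Set.Icc (0 : ℝ) 1) :=
    hg.continuousOn.integrableOn_compact isCompact_Icc
  have i2 : IntegrableOn (fun t => g t ^ 2) (Set.Icc (0 : ℝ) 1) :=
    (hg.pow 2).continuousOn.integrableOn_compact isCompact_Icc
  set c := ∫ t in Set.Icc (0 : ℝ) 1, g t
  have ic : IntegrableOn (fun _ : ℝ => c ^ 2) (Set.Icc (0 : ℝ) 1) := integrableOn_const (by simp)
  have h : ∫ t in Set.Icc (0 : ℝ) 1, (g t - c) ^ 2 =
      (∫ t in Set.Icc (0 : ℝ) 1, g t ^ 2) - c ^ 2 := by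
    have : (fun t => (g t - c) ^ 2) = fun t => (g t ^ 2 - 2 * c * g t) + c ^ 2 := by
      ext t; ring
    have i3 : IntegrableOn (fun t => g t ^ 2 - 2 * c * g t) (Set.Icc (0 : ℝ) 1) :=
      i2.sub (i1.const_mul _)
    rw [this, integral_add i3 ic, integral_sub i2 (i1.const_mul _),
      integral_const_mul, setIntegral_const]
    simp only [measureReal_def, Real.volume_Icc, sub_zero, ENNReal.ofReal_one, ENNReal.toReal_one,
      one_smul]
    ring
  have h0 : 0 ≤ ∫ t in Set.Icc (0 : ℝ) 1, (g t - c) ^ 2 := integral_nonneg fun t => sq_nonneg _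
  linarith

/-- Translation estimate: `‖φ(· + z) - φ‖ ≤ |z| ‖∇φ‖` in `L²`. -/
theorem integral_sq_translate_sub_le {φ : E n → ℝ} (hφ : ContDiff ℝ ∞ φ)
    (hc : HasCompactSupport φ) (z : E n) :
    ∫ x, (φ (x + z) - φ x) ^ 2 ≤ ‖z‖ ^ 2 * ∫ x, ‖∇ φ x‖ ^ 2 := by
  have hgc : Continuous (fderiv ℝ φ) := hφ.continuous_fderiv (by simp)
  obtain ⟨R, hR⟩ := (hc.fderiv (𝕜 := ℝ)).isCompact.isBounded.subset_closedBall (0 : E n)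
  set Ψ : ℝ × E n → ℝ := fun q => (fderiv ℝ φ (q.2 + q.1 • z) z) ^ 2 with hΨ
  have hΨc : Continuous Ψ :=
    ((hgc.comp (continuous_snd.add (continuous_fst.smul continuous_const))).clm_apply
        continuous_const).pow 2
  have hΨi : Integrable Ψ ((volume.restrict (Set.Icc (0 : ℝ) 1)).prod (volume : Measure (E n))) := by
    refine integrable_restrict_prod_of_continuous hΨc isCompact_Icc
      (isCompact_closedBall (0 : E n) (R + ‖z‖)) fun t ht x hx => ?_
    have : fderiv ℝ φ (x + t • z) = 0 := by
      by_contra h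
      apply hx
      have h1 := hR (subset_tsupport _ h)
      rw [mem_closedBall_zero_iff] at h1 ⊢
      have h2 : ‖t • z‖ ≤ ‖z‖ := by
        rw [norm_smul, Real.norm_of_nonneg ht.1]
        exact mul_le_of_le_one_left (norm_nonneg _) ht.2
      have h3 : ‖x‖ ≤ ‖x + t • z‖ + ‖t • z‖ := by
        simpa using norm_sub_le (x + t • z) (t • z)
      linarith
    simp [hΨ, this]
  -- The increment is the integral of the directional derivative along the segment. After Fubini,
  -- translation invariance removes the dependence on `t`.
  have hpt : ∀ x, (φ (x + z) - φ x) ^ 2 ≤ ∫ t in Set.Icc (0 : ℝ) 1, Ψ (t, x) := by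
    intro x
    have hd : ∀ t ∈ Set.uIcc (0 : ℝ) 1,
        HasDerivAt (fun t : ℝ => φ (x + t • z)) (fderiv ℝ φ (x + t • z) z) t := by
      intro t _
      have h1 : HasDerivAt (fun t : ℝ => x + t • z) z t := by
        simpa using ((hasDerivAt_id t).smul_const z).const_add x
      exact ((hφ.differentiable (by simp)) (x + t • z)).hasFDerivAt.comp_hasDerivAt t h1
    have hcont : Continuous fun t : ℝ => fderiv ℝ φ (x + t • z) z :=
      (hgc.comp (continuous_const.add (continuous_id.smul continuous_const))).clm_apply
        continuous_const
    have hint := intervalIntegral.integral_eq_sub_of_hasDerivAt hd (hcont.intervalIntegrable 0 1)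
    rw [one_smul, zero_smul, add_zero, intervalIntegral.integral_of_le zero_le_one,
      ← integral_Icc_eq_integral_Ioc] at hint
    rw [← hint]
    exact sq_integral_Icc_le hcont
  have hg2 : Integrable fun x => ‖∇ φ x‖ ^ 2 := by
    exact integrable_sq_of_hasCompactSupport (continuous_gradient hφ).norm
      (hasCompactSupport_gradient hc).norm
  calc ∫ x, (φ (x + z) - φ x) ^ 2 ≤ ∫ x, ∫ t in Set.Icc (0 : ℝ) 1, Ψ (t, x) :=
        integral_mono_of_nonneg (Eventually.of_forall fun x => sq_nonneg _) hΨi.integral_prod_right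
          (Eventually.of_forall hpt)
    _ = ∫ t in Set.Icc (0 : ℝ) 1, ∫ x, Ψ (t, x) :=
        (integral_integral_swap (f := fun t x => Ψ (t, x)) hΨi).symm
    _ = ∫ t in Set.Icc (0 : ℝ) 1, ∫ x, (fderiv ℝ φ x z) ^ 2 := by
        congr 1 with t
        exact integral_add_right_eq_self (fun x => (fderiv ℝ φ x z) ^ 2) (t • z)
    _ = ∫ x, (fderiv ℝ φ x z) ^ 2 := by simp
    _ ≤ ∫ x, ‖z‖ ^ 2 * ‖∇ φ x‖ ^ 2 := by
        refine integral_mono_of_nonneg (Eventually.of_forall fun x => sq_nonneg _)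
          (hg2.const_mul _) (Eventually.of_forall fun x => ?_)
        have h1 := (fderiv ℝ φ x).le_opNorm z
        rw [← norm_gradient] at h1
        change (fderiv ℝ φ x z) ^ 2 ≤ ‖z‖ ^ 2 * ‖∇ φ x‖ ^ 2
        rw [← mul_pow, ← sq_abs, mul_comm]
        exact pow_le_pow_left₀ (abs_nonneg _) h1 2
    _ = ‖z‖ ^ 2 * ∫ x, ‖∇ φ x‖ ^ 2 := integral_const_mul _ _

/-- Averaged translation estimate over a ball of translations. -/
theorem integral_setIntegral_closedBall_sq_sub_le {φ : E n → ℝ} (hφ : ContDiff ℝ ∞ φ)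
    (hc : HasCompactSupport φ) {r : ℝ} (hr : 0 ≤ r) :
    Integrable (fun x => ∫ z in closedBall (0 : E n) r, (φ (x + z) - φ x) ^ 2) ∧
    ∫ x, ∫ z in closedBall (0 : E n) r, (φ (x + z) - φ x) ^ 2 ≤
      volume.real (closedBall (0 : E n) r) * r ^ 2 * ∫ x, ‖∇ φ x‖ ^ 2 := by
  have hφc := hφ.continuous
  obtain ⟨R, hR⟩ := hc.isCompact.isBounded.subset_closedBall (0 : E n)
  set Ψ : E n × E n → ℝ := fun q => (φ (q.2 + q.1) - φ q.2) ^ 2 with hΨ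
  have hΨc : Continuous Ψ := by fun_prop
  have hout : ∀ y : E n, R < ‖y‖ → φ y = 0 := by
    intro y hy
    by_contra h
    have := mem_closedBall_zero_iff.1 (hR (subset_tsupport _ h))
    linarith
  have hΨi : Integrable Ψ
      ((volume.restrict (closedBall (0 : E n) r)).prod (volume : Measure (E n))) := by
    refine integrable_restrict_prod_of_continuous hΨc (isCompact_closedBall _ _)
      (isCompact_closedBall (0 : E n) (R + r)) fun z hz x hx => ?_
    rw [mem_closedBall_zero_iff] at hz hx
    have h3 : ‖x‖ ≤ ‖x + z‖ + ‖z‖ := by simpa using norm_sub_le (x + z) z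
    simp [hΨ, hout x (by linarith), hout (x + z) (by linarith)]
  refine ⟨hΨi.integral_prod_right, ?_⟩
  have hg : 0 ≤ ∫ x, ‖∇ φ x‖ ^ 2 := integral_nonneg fun x => by positivity
  calc ∫ x, ∫ z in closedBall (0 : E n) r, (φ (x + z) - φ x) ^ 2
      = ∫ z in closedBall (0 : E n) r, ∫ x, (φ (x + z) - φ x) ^ 2 :=
        (integral_integral_swap (f := fun z x => Ψ (z, x)) hΨi).symm
    _ ≤ ∫ z in closedBall (0 : E n) r, r ^ 2 * ∫ x, ‖∇ φ x‖ ^ 2 := by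
        refine setIntegral_mono_on hΨi.integral_prod_left ?_ measurableSet_closedBall ?_
        · exact integrableOn_const (measure_closedBall_lt_top.ne)
        · intro z hz
          refine (integral_sq_translate_sub_le hφ hc z).trans ?_
          rw [mem_closedBall_zero_iff] at hz
          gcongr
    _ = _ := by
        rw [setIntegral_const, smul_eq_mul, mul_assoc]

/-- The variance of `φ` on a set is controlled by the double integral of its increments. -/
theorem measureReal_mul_setIntegral_sq_le {φ : E n → ℝ} (hφ : Continuous φ)
    (hc : HasCompactSupport φ) {Q : Set (E n)} (hQm : MeasurableSet Q) (hQ : volume Q ≠ ⊤) {r : ℝ}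
    (hr : ∀ x ∈ Q, ∀ y ∈ Q, dist x y ≤ r)
    (hI : Integrable (fun x => ∫ z in closedBall (0 : E n) r, (φ (x + z) - φ x) ^ 2)) :
    volume.real Q * ∫ x in Q, φ x ^ 2 ≤ (∫ x in Q, φ x) ^ 2 +
      ∫ x in Q, ∫ z in closedBall (0 : E n) r, (φ (x + z) - φ x) ^ 2 := by
  have i1 : IntegrableOn φ Q := (hφ.integrable_of_hasCompactSupport hc).integrableOn
  have i2 : IntegrableOn (fun x => φ x ^ 2) Q :=
    (integrable_sq_of_hasCompactSupport hφ hc).integrableOn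
  have ic (a : ℝ) : IntegrableOn (fun _ : E n => a) Q := integrableOn_const hQ
  set S := ∫ x in Q, φ x
  set S2 := ∫ x in Q, φ x ^ 2
  set m := volume.real Q
  have hq (a b c : ℝ) : ∫ y in Q, (a * φ y ^ 2 + b * φ y + c) = a * S2 + b * S + m * c := by
    have i3 : IntegrableOn (fun y => a * φ y ^ 2 + b * φ y) Q :=
      (i2.const_mul a).add (i1.const_mul b)
    rw [integral_add i3 (ic c), integral_add (i2.const_mul a) (i1.const_mul b),
      integral_const_mul, integral_const_mul, setIntegral_const, smul_eq_mul]
  have hin : ∀ x, ∫ y in Q, (φ y - φ x) ^ 2 = m * φ x ^ 2 + -2 * S * φ x + S2 := by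
    intro x
    have : (fun y => (φ y - φ x) ^ 2) = fun y => 1 * φ y ^ 2 + -2 * φ x * φ y + φ x ^ 2 := by
      ext y; ring
    rw [this, hq]
    ring
  -- Expanding the square gives twice the quantity to be bounded; the spare factor 2 is given away
  -- at the end.
  have hout : ∫ x in Q, ∫ y in Q, (φ y - φ x) ^ 2 = 2 * (m * S2) - 2 * S ^ 2 := by
    simp_rw [hin]
    rw [hq]
    ring
  -- Substitute `y = x + z`: since `Q` has diameter at most `r`, it lies in the ball of radius `r`
  -- around each of its points.
  have hle : ∫ x in Q, ∫ y in Q, (φ y - φ x) ^ 2 ≤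
      ∫ x in Q, ∫ z in closedBall (0 : E n) r, (φ (x + z) - φ x) ^ 2 := by
    refine setIntegral_mono_on ?_ hI.integrableOn hQm fun x hx => ?_
    · simp_rw [hin]
      exact ((i2.const_mul _).add (i1.const_mul _)).add (ic _)
    · have h1 : ∫ z in closedBall (0 : E n) r, (φ (x + z) - φ x) ^ 2 =
          ∫ y in closedBall x r, (φ y - φ x) ^ 2 := by
        have := (measurePreserving_add_left volume x).setIntegral_preimage_emb
          (measurableEmbedding_addLeft x) (fun y => (φ y - φ x) ^ 2) (closedBall x r)
        rw [← this]
        simp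
      rw [h1]
      refine setIntegral_mono_set ?_ (Eventually.of_forall fun y => sq_nonneg _)
        (LE.le.eventuallyLE fun y hy => mem_closedBall.2 (hr y hy x hx))
      exact (by fun_prop : Continuous fun y => (φ y - φ x) ^ 2).continuousOn.integrableOn_compact
        (isCompact_closedBall x r)
  have h0 : 0 ≤ ∫ x in Q, ∫ z in closedBall (0 : E n) r, (φ (x + z) - φ x) ^ 2 :=
    integral_nonneg fun x => integral_nonneg fun z => sq_nonneg _
  linarith

end Smooth

/-! ### Friedrichs' inequality on a cubic grid. -/

section Grid

variable {n : ℕ}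

/-- The index of the cube with side `h` of the standard grid that contains `x`. -/
noncomputable def gridIndex (h : ℝ) (x : E n) : Fin n → ℤ := fun i => ⌊x i / h⌋

/-- The cube of the standard grid of mesh `h` with index `m`. -/
def gridCube (h : ℝ) (m : Fin n → ℤ) : Set (E n) := gridIndex h ⁻¹' {m}

theorem mem_gridCube {h : ℝ} (hh : 0 < h) {m : Fin n → ℤ} {x : E n} :
    x ∈ gridCube h m ↔ ∀ i, x i ∈ Set.Ico (m i * h) ((m i + 1) * h) := by
  simp only [gridCube, gridIndex, Set.mem_preimage, Set.mem_singleton_iff, funext_iff,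
    Int.floor_eq_iff, Set.mem_Ico, le_div_iff₀ hh, div_lt_iff₀ hh]

theorem gridCube_eq_preimage {h : ℝ} (hh : 0 < h) (m : Fin n → ℤ) :
    gridCube h m = (MeasurableEquiv.toLp 2 (Fin n → ℝ)).symm ⁻¹'
      (Set.univ.pi fun i => Set.Ico (m i * h) ((m i + 1) * h)) := by
  ext x
  rw [mem_gridCube hh]
  simp [Set.mem_pi]

theorem measurableSet_gridCube {h : ℝ} (hh : 0 < h) (m : Fin n → ℤ) :
    MeasurableSet (gridCube h m) := by
  rw [gridCube_eq_preimage hh]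
  exact (MeasurableEquiv.measurable _) (MeasurableSet.univ_pi fun i => measurableSet_Ico)

theorem volume_gridCube {h : ℝ} (hh : 0 < h) (m : Fin n → ℤ) :
    volume (gridCube h m) = ENNReal.ofReal (h ^ n) := by
  rw [gridCube_eq_preimage hh,
    (EuclideanSpace.volume_preserving_symm_measurableEquiv_toLp (Fin n)).measure_preimage
      (MeasurableSet.univ_pi fun i => measurableSet_Ico).nullMeasurableSet, Real.volume_pi_Ico]
  have : ∀ i, ((m i : ℝ) + 1) * h - m i * h = h := fun i => by ring
  simp [this, ENNReal.ofReal_pow hh.le]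

theorem dist_le_of_mem_gridCube {h : ℝ} (hh : 0 < h) {m : Fin n → ℤ} {x y : E n}
    (hx : x ∈ gridCube h m) (hy : y ∈ gridCube h m) : dist x y ≤ √n * h := by
  rw [mem_gridCube hh] at hx hy
  rw [EuclideanSpace.dist_eq, ← Real.sqrt_sq hh.le, ← Real.sqrt_mul (Nat.cast_nonneg n)]
  apply Real.sqrt_le_sqrt
  have : ∀ i ∈ Finset.univ, dist (x i) (y i) ^ 2 ≤ h ^ 2 := by
    intro i _
    have h1 := hx i
    have h2 := hy i
    rw [Set.mem_Ico] at h1 h2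
    refine pow_le_pow_left₀ dist_nonneg ?_ 2
    rw [Real.dist_eq, abs_le]
    constructor <;> nlinarith
  simpa using Finset.sum_le_sum this

/-- Coordinates on a bounded set are bounded, hence so are their floors. This is what makes the cube
averages a finite-rank observation in Rellich's theorem. -/
theorem finite_gridIndex_image {h : ℝ} (hh : 0 < h) {s : Set (E n)}
    (hs : Bornology.IsBounded s) : (gridIndex h '' s).Finite := by
  obtain ⟨R, hR⟩ := hs.subset_closedBall (0 : E n)
  refine (Set.finite_Icc (fun _ : Fin n => ⌊-R / h⌋) (fun _ => ⌊R / h⌋)).subset ?_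
  rintro _ ⟨x, hx, rfl⟩
  have h1 : ∀ i, |x i| ≤ R := fun i =>
    (PiLp.norm_apply_le x i).trans (mem_closedBall_zero_iff.1 (hR hx))
  refine ⟨fun i => Int.floor_mono ?_, fun i => Int.floor_mono ?_⟩
  · have := (abs_le.1 (h1 i)).1; gcongr
  · have := (abs_le.1 (h1 i)).2; gcongr

/-- Friedrichs' inequality on a grid: the `L²` norm of `φ` is controlled by a small multiple of
the norm of the gradient together with finitely many averages. -/
theorem integral_sq_le_gradient_add_sum_gridCube {φ : E n → ℝ} (hφ : ContDiff ℝ ∞ φ)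
    (hc : HasCompactSupport φ) {h : ℝ} (hh : 0 < h) {I : Finset (Fin n → ℤ)}
    (hI : ∀ x, φ x ≠ 0 → gridIndex h x ∈ I) :
    ∫ x, φ x ^ 2 ≤
      (√n ^ n * n * volume.real (closedBall (0 : E n) 1)) * h ^ 2 * (∫ x, ‖∇ φ x‖ ^ 2) +
        ∑ m ∈ I, (h ^ n)⁻¹ * (∫ x in gridCube h m, φ x) ^ 2 := by
  set r := √n * h with hr
  have hr0 : 0 ≤ r := by positivity
  obtain ⟨hGi, hG⟩ := integral_setIntegral_closedBall_sq_sub_le hφ hc hr0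
  set G : E n → ℝ := fun x => ∫ z in closedBall (0 : E n) r, (φ (x + z) - φ x) ^ 2
  have hG0 : ∀ x, 0 ≤ G x := fun x => integral_nonneg fun z => sq_nonneg _
  have hdisj : Set.Pairwise (I : Set (Fin n → ℤ)) (Function.onFun Disjoint (gridCube (n := n) h)) :=
    fun i _ j _ hij => Disjoint.preimage _ (Set.disjoint_singleton.2 hij)
  have hsum {g : E n → ℝ} (hg : Integrable g) :
      ∫ x in ⋃ m ∈ I, gridCube h m, g x = ∑ m ∈ I, ∫ x in gridCube h m, g x :=
    integral_biUnion_finset I (fun m _ => measurableSet_gridCube hh m) hdisj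
      fun m _ => hg.integrableOn
  have hφ2 := integrable_sq_of_hasCompactSupport hφ.continuous hc
  have h1 : ∫ x, φ x ^ 2 = ∑ m ∈ I, ∫ x in gridCube h m, φ x ^ 2 := by
    rw [← hsum hφ2]
    refine (setIntegral_eq_integral_of_forall_compl_eq_zero fun x hx => ?_).symm
    by_contra h0
    refine hx (Set.mem_biUnion (hI x fun h => h0 (by simp [h])) ?_)
    rfl
  have hvol (m : Fin n → ℤ) : volume.real (gridCube (n := n) h m) = h ^ n := by
    rw [measureReal_def, volume_gridCube hh, ENNReal.toReal_ofReal (by positivity)]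
  have h2 : ∀ m ∈ I, ∫ x in gridCube h m, φ x ^ 2 ≤
      (h ^ n)⁻¹ * (∫ x in gridCube h m, φ x) ^ 2 + (h ^ n)⁻¹ * ∫ x in gridCube h m, G x := by
    intro m _
    have := measureReal_mul_setIntegral_sq_le hφ.continuous hc (measurableSet_gridCube hh m)
      (by rw [volume_gridCube hh]; exact ENNReal.ofReal_ne_top)
      (fun x hx y hy => dist_le_of_mem_gridCube hh hx hy) hGi
    rw [hvol] at this
    rw [← mul_add, inv_mul_eq_div, le_div_iff₀ (by positivity), mul_comm]
    exact this
  -- The cubes are disjoint, so no factor counting them appears.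
  have h3 : ∑ m ∈ I, ∫ x in gridCube h m, G x ≤ ∫ x, G x := by
    rw [← hsum hGi]
    exact setIntegral_le_integral hGi (Eventually.of_forall hG0)
  have h4 : volume.real (closedBall (0 : E n) r) = r ^ n * volume.real (closedBall (0 : E n) 1) := by
    rw [measureReal_def, Measure.addHaar_closedBall' _ _ hr0, ENNReal.toReal_mul,
      ENNReal.toReal_ofReal (by positivity), measureReal_def, finrank_euclideanSpace_fin]
  calc ∫ x, φ x ^ 2 ≤ ∑ m ∈ I, ((h ^ n)⁻¹ * (∫ x in gridCube h m, φ x) ^ 2 +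
        (h ^ n)⁻¹ * ∫ x in gridCube h m, G x) := h1.trans_le (Finset.sum_le_sum h2)
    _ = (h ^ n)⁻¹ * (∑ m ∈ I, ∫ x in gridCube h m, G x) +
        ∑ m ∈ I, (h ^ n)⁻¹ * (∫ x in gridCube h m, φ x) ^ 2 := by
      rw [Finset.sum_add_distrib, Finset.mul_sum, add_comm]
    _ ≤ (h ^ n)⁻¹ * (volume.real (closedBall (0 : E n) r) * r ^ 2 * ∫ x, ‖∇ φ x‖ ^ 2) +
        ∑ m ∈ I, (h ^ n)⁻¹ * (∫ x in gridCube h m, φ x) ^ 2 := by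
      gcongr
      exact h3.trans hG
    -- The factor `h ^ n` in the volume of the ball of radius `√n * h` cancels the inverse volume of
    -- a cube, leaving the small factor `h ^ 2`.
    _ = _ := by
      rw [h4, hr, mul_pow, mul_pow, Real.sq_sqrt (Nat.cast_nonneg n)]
      field_simp

end Grid

/-! ### `H¹₀` as a closed subspace of `L² × L²`, and Rellich's theorem. -/

section SobolevSpace

variable {n : ℕ} {Ω : Set (E n)}

theorem IsTestFunction.memLp {φ : E n → ℝ} (hφ : IsTestFunction Ω φ) : MemLp φ 2 (vol Ω) :=
  (hφ.smooth.continuous.memLp_of_hasCompactSupport hφ.compact).restrict _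

theorem IsTestFunction.memLp_gradient {φ : E n → ℝ} (hφ : IsTestFunction Ω φ) :
    MemLp (∇ φ) 2 (vol Ω) :=
  ((continuous_gradient hφ.smooth).memLp_of_hasCompactSupport
    (hasCompactSupport_gradient hφ.compact)).restrict _

theorem IsTestFunction.eq_zero {φ : E n → ℝ} (hφ : IsTestFunction Ω φ) {x : E n} (hx : x ∉ Ω) :
    φ x = 0 :=
  image_eq_zero_of_notMem_tsupport fun h => hx (hφ.support h)

theorem IsTestFunction.gradient_eq_zero {φ : E n → ℝ} (hφ : IsTestFunction Ω φ) {x : E n}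
    (hx : x ∉ Ω) : ∇ φ x = 0 :=
  image_eq_zero_of_notMem_tsupport fun h => hx (hφ.support (tsupport_gradient_subset φ h))

theorem isTestFunction_zero : IsTestFunction Ω (0 : E n → ℝ) :=
  ⟨contDiff_const, .zero, by simp⟩

theorem IsTestFunction.add {φ ψ : E n → ℝ} (hφ : IsTestFunction Ω φ) (hψ : IsTestFunction Ω ψ) :
    IsTestFunction Ω (φ + ψ) :=
  ⟨hφ.smooth.add hψ.smooth, hφ.compact.add hψ.compact,
    (tsupport_add φ ψ).trans (Set.union_subset hφ.support hψ.support)⟩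

theorem IsTestFunction.const_smul {φ : E n → ℝ} (hφ : IsTestFunction Ω φ) (c : ℝ) :
    IsTestFunction Ω (c • φ) :=
  ⟨hφ.smooth.const_smul c, hφ.compact.smul_left (f := fun _ => c),
    (tsupport_smul_subset_right (fun _ => c) φ).trans hφ.support⟩

theorem IsTestFunction.gradient_add {φ ψ : E n → ℝ} (hφ : IsTestFunction Ω φ)
    (hψ : IsTestFunction Ω ψ) : ∇ (φ + ψ) = ∇ φ + ∇ ψ := by
  ext1 x
  simp only [gradient, Pi.add_apply]
  rw [fderiv_add ((hφ.smooth.differentiable (by simp)) x) ((hψ.smooth.differentiable (by simp)) x),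
    map_add]

theorem IsTestFunction.gradient_const_smul {φ : E n → ℝ} (hφ : IsTestFunction Ω φ) (c : ℝ) :
    ∇ (c • φ) = c • ∇ φ := by
  ext1 x
  simp only [gradient, Pi.smul_apply]
  rw [fderiv_const_smul ((hφ.smooth.differentiable (by simp)) x), map_smul]

/-- Test functions vanish off `Ω`, so this is integration by parts on the whole space, without
boundary terms. -/
theorem integral_inner_gradient_eq_neg {φ ψ : E n → ℝ} (hφ : IsTestFunction Ω φ)
    (hψ : IsTestFunction Ω ψ) (e : E n) :
    ∫ x in Ω, φ x * inner ℝ (∇ ψ x) e = -∫ x in Ω, ψ x * inner ℝ (∇ φ x) e := by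
  have hint {f g : E n → ℝ} (hf : IsTestFunction Ω f) (hg : IsTestFunction Ω g) :
      Integrable fun x => f x * fderiv ℝ g x e :=
    (hf.smooth.continuous.mul ((hg.smooth.continuous_fderiv (by simp)).clm_apply
      continuous_const)).integrable_of_hasCompactSupport hf.compact.mul_right
  rw [setIntegral_eq_integral_of_forall_compl_eq_zero fun x hx => by simp [hφ.eq_zero hx],
    setIntegral_eq_integral_of_forall_compl_eq_zero fun x hx => by simp [hψ.eq_zero hx]]
  simp_rw [inner_gradient]
  rw [integral_mul_fderiv_eq_neg_fderiv_mul_of_integrable ?_ (hint hφ hψ) ?_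
    (fun x _ => hφ.smooth.differentiable (by simp) x)
    (fun x _ => hψ.smooth.differentiable (by simp) x)]
  · simp_rw [mul_comm]
  · simpa only [mul_comm] using hint hψ hφ
  · exact (hφ.smooth.continuous.mul hψ.smooth.continuous).integrable_of_hasCompactSupport
      hφ.compact.mul_right

/-- The space `L²(Ω) × L²(Ω; ℝⁿ)` in which `H¹(Ω)` embeds by `u ↦ (u, ∇u)`. -/
abbrev L2Pair (Ω : Set (E n)) : Type := WithLp 2 (Lp ℝ 2 (vol Ω) × Lp (E n) 2 (vol Ω))

/-- The pairs `(φ, ∇φ)` with `φ` a test function. -/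
noncomputable def testPairs (Ω : Set (E n)) : Submodule ℝ (L2Pair Ω) where
  carrier := {z | ∃ φ, IsTestFunction Ω φ ∧ z.fst =ᵐ[vol Ω] φ ∧ z.snd =ᵐ[vol Ω] ∇ φ}
  zero_mem' := ⟨0, isTestFunction_zero, Lp.coeFn_zero _ _ _, by
    have : ∇ (0 : E n → ℝ) = 0 := by ext1 x; simp [gradient]
    rw [this]
    exact Lp.coeFn_zero _ _ _⟩
  add_mem' := by
    rintro a b ⟨φ, hφ, h1, h2⟩ ⟨ψ, hψ, h3, h4⟩
    refine ⟨φ + ψ, hφ.add hψ, ?_, ?_⟩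
    · exact (Lp.coeFn_add a.fst b.fst).trans (h1.add h3)
    · rw [hφ.gradient_add hψ]
      exact (Lp.coeFn_add a.snd b.snd).trans (h2.add h4)
  smul_mem' := by
    rintro c a ⟨φ, hφ, h1, h2⟩
    refine ⟨c • φ, hφ.const_smul c, ?_, ?_⟩
    · exact (Lp.coeFn_smul c a.fst).trans (h1.const_smul c)
    · rw [hφ.gradient_const_smul]
      exact (Lp.coeFn_smul c a.snd).trans (h2.const_smul c)

/-- The Hilbert space `H¹₀(Ω)`. -/
noncomputable def H10 (Ω : Set (E n)) : Submodule ℝ (L2Pair Ω) := (testPairs Ω).topologicalClosure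

instance : CompleteSpace (H10 Ω) :=
  (Submodule.isClosed_topologicalClosure (testPairs Ω)).completeSpace_coe

theorem H10_induction {P : L2Pair Ω → Prop} (hP : IsClosed {z | P z})
    (h : ∀ z ∈ testPairs Ω, P z) {z : L2Pair Ω} (hz : z ∈ H10 Ω) : P z :=
  closure_minimal (s := (testPairs Ω : Set (L2Pair Ω))) h hP hz

theorem continuous_fst_L2Pair : Continuous fun z : L2Pair Ω => z.fst :=
  (WithLp.fstL 2 ℝ (Lp ℝ 2 (vol Ω)) (Lp (E n) 2 (vol Ω))).continuous

theorem continuous_snd_L2Pair : Continuous fun z : L2Pair Ω => z.snd :=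
  (WithLp.sndL 2 ℝ (Lp ℝ 2 (vol Ω)) (Lp (E n) 2 (vol Ω))).continuous

theorem inner_toLp {F : Type*} [NormedAddCommGroup F] [InnerProductSpace ℝ F] {u v : E n → F}
    (hu : MemLp u 2 (vol Ω)) (hv : MemLp v 2 (vol Ω)) :
    inner ℝ (hu.toLp u) (hv.toLp v) = ∫ x in Ω, inner ℝ (u x) (v x) := by
  rw [L2.inner_def]
  refine integral_congr_ae ?_
  filter_upwards [hu.coeFn_toLp, hv.coeFn_toLp] with x h1 h2
  rw [h1, h2]

theorem norm_sq_eq_integral_of_ae_eq {F : Type*} [NormedAddCommGroup F] [InnerProductSpace ℝ F]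
    {u : Lp F 2 (vol Ω)} {v : E n → F} (h : u =ᵐ[vol Ω] v) : ‖u‖ ^ 2 = ∫ x in Ω, ‖v x‖ ^ 2 := by
  rw [← real_inner_self_eq_norm_sq, L2.inner_def]
  refine integral_congr_ae ?_
  filter_upwards [h] with x hx
  rw [hx, real_inner_self_eq_norm_sq]

/-- Paired with a fixed vector `e`, the weak gradient identity equates two continuous linear
functionals of the pair. It is thus a closed condition, and on test pairs it is integration by
parts. -/
theorem isWeakGradient_of_mem_H10 {z : L2Pair Ω} (hz : z ∈ H10 Ω) :
    IsWeakGradient Ω z.fst z.snd := by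
  refine ⟨Lp.memLp _, fun ψ hψ => ?_⟩
  have hu := Lp.memLp z.fst
  have hg := Lp.memLp z.snd
  have i1 : Integrable (fun x => z.fst x • ∇ ψ x) (vol Ω) :=
    memLp_one_iff_integrable.1 (hψ.memLp_gradient.smul hu)
  have i2 : Integrable (fun x => ψ x • z.snd x) (vol Ω) :=
    memLp_one_iff_integrable.1 (hg.smul hψ.memLp)
  refine ext_inner_left ℝ fun e => ?_
  rw [inner_neg_right, ← integral_inner i1, ← integral_inner i2]
  have m1 : MemLp (fun x => inner ℝ (∇ ψ x) e) 2 (vol Ω) := hψ.memLp_gradient.inner_const e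
  have m2 : MemLp (fun x => ψ x • e) 2 (vol Ω) := (ContinuousLinearMap.toSpanSingleton ℝ e).comp_memLp' hψ.memLp
  have e1 (w : L2Pair Ω) :
      inner ℝ (m1.toLp _) w.fst = ∫ x in Ω, inner ℝ e (w.fst x • ∇ ψ x) := by
    rw [L2.inner_def]
    refine integral_congr_ae ?_
    filter_upwards [m1.coeFn_toLp] with x hx
    rw [hx, real_inner_smul_right, real_inner_comm e, Real.inner_apply, mul_comm]
  have e2 (w : L2Pair Ω) :
      inner ℝ (m2.toLp _) w.snd = ∫ x in Ω, inner ℝ e (ψ x • w.snd x) := by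
    rw [L2.inner_def]
    refine integral_congr_ae ?_
    filter_upwards [m2.coeFn_toLp] with x hx
    rw [hx, real_inner_smul_right, real_inner_smul_left]
  rw [← e1, ← e2]
  refine H10_induction (P := fun w => inner ℝ (m1.toLp _) w.fst = -inner ℝ (m2.toLp _) w.snd)
    (isClosed_eq (continuous_const.inner continuous_fst_L2Pair)
      (continuous_const.inner continuous_snd_L2Pair).neg) ?_ hz
  rintro w ⟨φ, hφ, h1, h2⟩
  rw [e1, e2]
  have e3 : ∫ x in Ω, inner ℝ e (w.fst x • ∇ ψ x) = ∫ x in Ω, φ x * inner ℝ (∇ ψ x) e := by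
    refine integral_congr_ae ?_
    filter_upwards [h1] with x hx
    rw [hx, real_inner_smul_right, real_inner_comm e]
  have e4 : ∫ x in Ω, inner ℝ e (ψ x • w.snd x) = ∫ x in Ω, ψ x * inner ℝ (∇ φ x) e := by
    refine integral_congr_ae ?_
    filter_upwards [h2] with x hx
    rw [hx, real_inner_smul_right, real_inner_comm e]
  rw [e3, e4]
  exact integral_inner_gradient_eq_neg hφ hψ e

/-- By the fundamental lemma of the calculus of variations, applied to the difference. It makes the
choice in `weakGrad` harmless. -/
theorem IsWeakGradient.ae_eq (hΩ : IsOpen Ω) [IsFiniteMeasure (vol Ω)] {u : E n → ℝ}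
    {g₁ g₂ : E n → E n} (h₁ : IsWeakGradient Ω u g₁) (h₂ : IsWeakGradient Ω u g₂) :
    g₁ =ᵐ[vol Ω] g₂ := by
  have hi : Integrable (g₁ - g₂) (vol Ω) := (h₁.1.sub h₂.1).integrable (by norm_num)
  have h := hΩ.ae_eq_zero_of_integral_contDiff_smul_eq_zero (μ := volume) (f := g₁ - g₂)
    (IntegrableOn.locallyIntegrableOn hi) fun ψ hs hc ht => by
      have hψ : IsTestFunction Ω ψ := ⟨hs, hc, ht⟩
      rw [← setIntegral_eq_integral_of_forall_compl_eq_zero (s := Ω)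
        fun x hx => by simp [hψ.eq_zero hx]]
      have i1 : Integrable (fun x => ψ x • g₁ x) (vol Ω) :=
        memLp_one_iff_integrable.1 (h₁.1.smul hψ.memLp)
      have i2 : Integrable (fun x => ψ x • g₂ x) (vol Ω) :=
        memLp_one_iff_integrable.1 (h₂.1.smul hψ.memLp)
      simp only [Pi.sub_apply, smul_sub]
      rw [integral_sub i1 i2, sub_eq_zero, ← neg_inj, ← h₁.2 ψ hψ, ← h₂.2 ψ hψ]
  rw [Filter.EventuallyEq, ae_restrict_iff' hΩ.measurableSet]
  filter_upwards [h] with x hx hxΩ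
  exact sub_eq_zero.1 (hx hxΩ)

theorem MemH1.isWeakGradient {u : E n → ℝ} (hu : MemH1 Ω u) :
    IsWeakGradient Ω u (weakGrad Ω u) := by
  rw [weakGrad, dif_pos hu.2]
  exact hu.2.choose_spec

/-- The element of `L²(Ω) × L²(Ω; ℝⁿ)` given by `u ∈ H¹(Ω)` and its weak gradient. -/
noncomputable def MemH1.toPair {u : E n → ℝ} (hu : MemH1 Ω u) : L2Pair Ω :=
  WithLp.toLp 2 (hu.1.toLp u, hu.isWeakGradient.1.toLp (weakGrad Ω u))

theorem tendsto_toLp_of_eLpNorm {F : Type*} [NormedAddCommGroup F] {w : ℕ → E n → F} {u : E n → F}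
    (hw : ∀ m, MemLp (w m) 2 (vol Ω)) (hu : MemLp u 2 (vol Ω))
    (h : Tendsto (fun m => eLpNorm (fun x => w m x - u x) 2 (vol Ω)) atTop (𝓝 0)) :
    Tendsto (fun m => (hw m).toLp (w m)) atTop (𝓝 (hu.toLp u)) :=
  (Lp.tendsto_Lp_iff_tendsto_eLpNorm'' w hw u hu).2 h

theorem MemH10.toPair_mem {u : E n → ℝ} (hu : MemH10 Ω u) : hu.1.toPair ∈ H10 Ω := by
  obtain ⟨φ, hφ, h1, h2⟩ := hu.2
  have t1 := tendsto_toLp_of_eLpNorm (fun m => (hφ m).memLp) hu.1.1 h1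
  have t2 := tendsto_toLp_of_eLpNorm (fun m => (hφ m).memLp_gradient) hu.1.isWeakGradient.1 h2
  have t := ((WithLp.prod_continuous_toLp 2 (Lp ℝ 2 (vol Ω)) (Lp (E n) 2 (vol Ω))).tendsto _).comp
    (t1.prodMk_nhds t2)
  refine mem_closure_of_tendsto t (Eventually.of_forall fun m => ?_)
  exact ⟨φ m, hφ m, (hφ m).memLp.coeFn_toLp, (hφ m).memLp_gradient.coeFn_toLp⟩

/-- The converse of `MemH10.toPair_mem`: uniqueness of weak gradients forces the second component,
and a sequence of test pairs converging to `z` supplies the approximation. -/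
theorem memH10_of_mem (hΩ : IsOpen Ω) [IsFiniteMeasure (vol Ω)] {z : L2Pair Ω} (hz : z ∈ H10 Ω) :
    MemH10 Ω z.fst ∧ weakGrad Ω z.fst =ᵐ[vol Ω] z.snd := by
  have hg := isWeakGradient_of_mem_H10 hz
  have h1 : MemH1 Ω z.fst := ⟨Lp.memLp _, _, hg⟩
  have hae := h1.isWeakGradient.ae_eq hΩ hg
  refine ⟨⟨h1, ?_⟩, hae⟩
  obtain ⟨w, hw, hlim⟩ := mem_closure_iff_seq_limit.1 hz
  choose φ hφ hφ1 hφ2 using hw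
  refine ⟨φ, hφ, ?_, ?_⟩
  · have t := (Lp.tendsto_Lp_iff_tendsto_eLpNorm' _ _).1
      ((continuous_fst_L2Pair.tendsto z).comp hlim)
    refine t.congr fun m => eLpNorm_congr_ae ?_
    filter_upwards [hφ1 m] with x hx
    simp [← hx]
  · have t := (Lp.tendsto_Lp_iff_tendsto_eLpNorm' _ _).1
      ((continuous_snd_L2Pair.tendsto z).comp hlim)
    refine t.congr fun m => eLpNorm_congr_ae ?_
    filter_upwards [hφ2 m, hae] with x hx hx'
    simp [← hx, hx']

/-- The embedding of `H¹₀(Ω)` in `L²(Ω)`. -/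
noncomputable def embL2 (Ω : Set (E n)) : H10 Ω →L[ℝ] Lp ℝ 2 (vol Ω) :=
  (WithLp.fstL 2 ℝ (Lp ℝ 2 (vol Ω)) (Lp (E n) 2 (vol Ω))) ∘L (H10 Ω).subtypeL

/-- **Rellich's theorem**: for bounded `Ω` the embedding of `H¹₀(Ω)` in `L²(Ω)` is compact. -/
theorem isCompactOperator_embL2 (hb : Bornology.IsBounded Ω) :
    IsCompactOperator (embL2 Ω) := by
  refine isCompactOperator_of_forall_norm_sq_le _ fun δ hδ => ?_
  set C := √n ^ n * n * volume.real (closedBall (0 : E n) 1)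
  have hC : 0 ≤ C := by positivity
  -- The denominator `C + 1` in the witness avoids dividing by a possibly zero `C`.
  obtain ⟨h, hh, hCh⟩ : ∃ h > 0, C * h ^ 2 ≤ δ := by
    refine ⟨√(δ / (C + 1)), by positivity, ?_⟩
    rw [Real.sq_sqrt (by positivity), mul_div_assoc', div_le_iff₀ (by positivity)]
    nlinarith
  have hfin := finite_gridIndex_image hh hb
  set I := hfin.toFinset
  have hμ (m : Fin n → ℤ) : vol Ω (gridCube h m) ≠ ⊤ := by
    refine ne_top_of_le_ne_top ?_ (Measure.restrict_apply_le _ _)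
    rw [volume_gridCube hh]
    exact ENNReal.ofReal_ne_top
  -- With this scaling the squared norm of `R` is exactly the sum of averages in Friedrichs'
  -- inequality.
  let ℓ (m : Fin n → ℤ) : L2Pair Ω →L[ℝ] ℝ := (√(h ^ n))⁻¹ •
    (innerSL ℝ (indicatorConstLp 2 (measurableSet_gridCube hh m) (hμ m) (1 : ℝ))) ∘L
      (WithLp.fstL 2 ℝ (Lp ℝ 2 (vol Ω)) (Lp (E n) 2 (vol Ω)))
  let e := I.equivFin
  let R : L2Pair Ω →L[ℝ] EuclideanSpace ℝ (Fin I.card) :=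
    (EuclideanSpace.equiv (Fin I.card) ℝ).symm.toContinuousLinearMap ∘L
      ContinuousLinearMap.pi fun j => ℓ (e.symm j)
  refine ⟨I.card, R ∘L (H10 Ω).subtypeL, ?_⟩
  rintro ⟨z, hz⟩
  -- Both sides are continuous in the pair, so Friedrichs' inequality is needed only for test
  -- functions.
  refine H10_induction (P := fun z => ‖z.fst‖ ^ 2 ≤ δ * ‖z‖ ^ 2 + ‖R z‖ ^ 2) ?_ ?_ hz
  · exact isClosed_le (continuous_fst_L2Pair.norm.pow 2)
      ((continuous_const.mul (continuous_norm.pow 2)).add (R.continuous.norm.pow 2))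
  rintro w ⟨φ, hφ, h1, h2⟩
  have hR : ‖R w‖ ^ 2 = ∑ m ∈ I, (h ^ n)⁻¹ * (∫ x in gridCube h m, φ x) ^ 2 := by
    rw [EuclideanSpace.norm_sq_eq, ← Finset.sum_coe_sort I, ← e.symm.sum_comp]
    refine Finset.sum_congr rfl fun j _ => ?_
    have : R w j = (√(h ^ n))⁻¹ * ∫ x in gridCube h (e.symm j), φ x := by
      change (√(h ^ n))⁻¹ * inner ℝ (indicatorConstLp 2 _ _ (1 : ℝ)) w.fst = _
      rw [L2.inner_indicatorConstLp_one (𝕜 := ℝ)]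
      congr 1
      rw [integral_congr_ae (ae_restrict_of_ae h1),
        Measure.restrict_restrict (measurableSet_gridCube hh _)]
      symm
      exact setIntegral_eq_of_subset_of_forall_sdiff_eq_zero (measurableSet_gridCube hh _)
        Set.inter_subset_left fun x hx => hφ.eq_zero fun hxΩ => hx.2 ⟨hx.1, hxΩ⟩
    rw [this, norm_mul, mul_pow, norm_inv, inv_pow, Real.norm_eq_abs, sq_abs,
      Real.sq_sqrt (by positivity), Real.norm_eq_abs, sq_abs]
  have hn1 : ‖w.fst‖ ^ 2 = ∫ x, φ x ^ 2 := by
    rw [norm_sq_eq_integral_of_ae_eq h1,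
      setIntegral_eq_integral_of_forall_compl_eq_zero fun x hx => by simp [hφ.eq_zero hx]]
    simp
  have hn2 : ‖w.snd‖ ^ 2 = ∫ x, ‖∇ φ x‖ ^ 2 := by
    rw [norm_sq_eq_integral_of_ae_eq h2,
      setIntegral_eq_integral_of_forall_compl_eq_zero fun x hx => by simp [hφ.gradient_eq_zero hx]]
  rw [hR, WithLp.prod_norm_sq_eq_of_L2, hn1, hn2]
  have hmain := integral_sq_le_gradient_add_sum_gridCube hφ.smooth hφ.compact hh (I := I)
    fun x hx => by
      rw [Set.Finite.mem_toFinset]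
      exact ⟨x, by_contra fun h => hx (hφ.eq_zero h), rfl⟩
  refine hmain.trans ?_
  have p1 : 0 ≤ ∫ x, φ x ^ 2 := integral_nonneg fun x => sq_nonneg _
  have p2 : 0 ≤ ∫ x, ‖∇ φ x‖ ^ 2 := integral_nonneg fun x => sq_nonneg _
  have p3 := mul_le_mul_of_nonneg_right hCh p2
  have p4 := mul_nonneg hδ.le p1
  linarith

end SobolevSpace

/-! ### The state, adjoint and functional in the Hilbert space of pairs. -/

section Variational

variable {n : ℕ} {Ω : Set (E n)}

theorem toPair_memH10_of_mem (hΩ : IsOpen Ω) [IsFiniteMeasure (vol Ω)] {z : L2Pair Ω}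
    (hz : z ∈ H10 Ω) : (memH10_of_mem hΩ hz).1.1.toPair = z := by
  have h1 : (Lp.memLp z.fst).toLp _ = z.fst := Lp.toLp_coeFn _ _
  have h2 : (memH10_of_mem hΩ hz).1.1.isWeakGradient.1.toLp _ = z.snd :=
    Lp.ext ((MemLp.coeFn_toLp _).trans (memH10_of_mem hΩ hz).2)
  change WithLp.toLp 2 (_, _) = z
  rw [h1, h2]
  rfl

/-- The Helmholtz form on pairs `(u, ∇u)`. -/
noncomputable def pairForm (k : ℝ) (z w : L2Pair Ω) : ℝ :=
  inner ℝ z w - (1 + k ^ 2) * inner ℝ z.fst w.fst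

theorem inner_toPair {u v : E n → ℝ} (hu : MemH1 Ω u) (hv : MemH1 Ω v) :
    inner ℝ hu.toPair hv.toPair =
      (∫ x in Ω, u x * v x) + ∫ x in Ω, inner ℝ (weakGrad Ω u x) (weakGrad Ω v x) := by
  rw [WithLp.prod_inner_apply]
  change inner ℝ (hu.1.toLp u) (hv.1.toLp v) +
    inner ℝ (hu.isWeakGradient.1.toLp _) (hv.isWeakGradient.1.toLp _) = _
  rw [inner_toLp, inner_toLp]
  simp only [Real.inner_apply]

/-- The scalar product of pairs already contains `∫ u v`, which shifts `k ^ 2` to `1 + k ^ 2`. The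
shifted constant is positive even for `k = 0`, as the abstract stability result requires. -/
theorem helmholtzForm_eq_pairForm (k : ℝ) {u v : E n → ℝ} (hu : MemH1 Ω u) (hv : MemH1 Ω v) :
    helmholtzForm Ω k u v = pairForm k hu.toPair hv.toPair := by
  have h : inner ℝ hu.toPair.fst hv.toPair.fst = ∫ x in Ω, u x * v x := by
    change inner ℝ (hu.1.toLp u) (hv.1.toLp v) = _
    rw [inner_toLp]
    simp only [Real.inner_apply]
  rw [helmholtzForm, pairForm, inner_toPair, h, integral_const_mul]
  ring

theorem IsHelmholtzSolution.pairForm_eq (hΩ : IsOpen Ω) [IsFiniteMeasure (vol Ω)] {k : ℝ}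
    {f u : E n → ℝ} (hu : IsHelmholtzSolution Ω k f u) (hf : MemLp f 2 (vol Ω)) {z : L2Pair Ω}
    (hz : z ∈ H10 Ω) : pairForm k hu.1.1.toPair z = inner ℝ (hf.toLp f) z.fst := by
  obtain ⟨v, hv, rfl⟩ : ∃ v, ∃ hv : MemH10 Ω v, hv.1.toPair = z :=
    ⟨_, (memH10_of_mem hΩ hz).1, toPair_memH10_of_mem hΩ hz⟩
  rw [← helmholtzForm_eq_pairForm, hu.2 v hv]
  change _ = inner ℝ (hf.toLp f) (hv.1.1.toLp v)
  rw [inner_toLp]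
  simp only [Real.inner_apply]

/-- The data `(η₀, A)` of the tracking functional as an element of `L²(Ω) × L²(Ω; ℝⁿ)`. -/
noncomputable def trackingData {A : E n → E n} (hA : MemLp A 2 (vol Ω)) {η₀ : E n → ℝ}
    (hη₀ : MemLp η₀ 2 (vol Ω)) : L2Pair Ω :=
  WithLp.toLp 2 (hη₀.toLp η₀, hA.toLp A)

theorem toPair_sub_trackingData {A : E n → E n} (hA : MemLp A 2 (vol Ω)) {η₀ : E n → ℝ}
    (hη₀ : MemLp η₀ 2 (vol Ω)) {u : E n → ℝ} (hu : MemH1 Ω u) :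
    hu.toPair - trackingData hA hη₀ = WithLp.toLp 2 ((hu.1.sub hη₀).toLp (u - η₀),
      (hu.isWeakGradient.1.sub hA).toLp (weakGrad Ω u - A)) := rfl

theorem trackingFunctional_eq_norm_sq {A : E n → E n} (hA : MemLp A 2 (vol Ω)) {η₀ : E n → ℝ}
    (hη₀ : MemLp η₀ 2 (vol Ω)) {u : E n → ℝ} (hu : MemH1 Ω u) :
    trackingFunctional Ω A η₀ u = ‖hu.toPair - trackingData hA hη₀‖ ^ 2 := by
  rw [toPair_sub_trackingData, WithLp.prod_norm_sq_eq_of_L2, trackingFunctional, add_comm]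
  change _ = ‖(hu.1.sub hη₀).toLp (u - η₀)‖ ^ 2 +
    ‖(hu.isWeakGradient.1.sub hA).toLp (weakGrad Ω u - A)‖ ^ 2
  rw [norm_sq_eq_integral_of_ae_eq (MemLp.coeFn_toLp _),
    norm_sq_eq_integral_of_ae_eq (MemLp.coeFn_toLp _)]
  simp

/-- The right-hand side is minus the derivative of the squared distance in the direction `z`; the
adjoint state represents it through the state form. -/
theorem IsAdjointState.pairForm_eq (hΩ : IsOpen Ω) [IsFiniteMeasure (vol Ω)] {k : ℝ}
    {A : E n → E n} (hA : MemLp A 2 (vol Ω)) {η₀ : E n → ℝ} (hη₀ : MemLp η₀ 2 (vol Ω))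
    {u p : E n → ℝ} (hu : MemH1 Ω u) (hp : IsAdjointState Ω k A η₀ u p) {z : L2Pair Ω}
    (hz : z ∈ H10 Ω) :
    pairForm k z hp.1.1.toPair = -2 * inner ℝ (hu.toPair - trackingData hA hη₀) z := by
  obtain ⟨v, hv, rfl⟩ : ∃ v, ∃ hv : MemH10 Ω v, hv.1.toPair = z :=
    ⟨_, (memH10_of_mem hΩ hz).1, toPair_memH10_of_mem hΩ hz⟩
  rw [← helmholtzForm_eq_pairForm, hp.2 v hv, toPair_sub_trackingData, WithLp.prod_inner_apply]
  change _ = -2 * (inner ℝ ((hu.1.sub hη₀).toLp (u - η₀)) (hv.1.1.toLp v) +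
    inner ℝ ((hu.isWeakGradient.1.sub hA).toLp (weakGrad Ω u - A)) (hv.1.isWeakGradient.1.toLp _))
  rw [inner_toLp, inner_toLp]
  simp only [Real.inner_apply, Pi.sub_apply]
  ring

/-- Stability of the Helmholtz problem away from the Dirichlet spectrum. -/
theorem exists_norm_le_adjoint_embL2 (hΩ : IsOpen Ω) (hb : Bornology.IsBounded Ω)
    [IsFiniteMeasure (vol Ω)] {k : ℝ} (hk : ¬ IsDirichletEigenvalue Ω (k ^ 2)) :
    ∃ C : ℝ, 0 ≤ C ∧ ∀ (z : H10 Ω) (F : Lp ℝ 2 (vol Ω)),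
      (∀ w ∈ H10 Ω, pairForm k z w = inner ℝ F w.fst) → ‖z‖ ≤ C * ‖(embL2 Ω).adjoint F‖ := by
  have h0 : ∀ z : H10 Ω,
      (∀ w : H10 Ω, inner ℝ z w = (1 + k ^ 2) * inner ℝ (embL2 Ω z) (embL2 Ω w)) → z = 0 := by
    intro z hz
    by_contra hne
    refine hk ⟨(z : L2Pair Ω).fst, (memH10_of_mem hΩ z.2).1, fun h0 => hne ?_, fun v hv => ?_⟩
    -- An eigenfunction must be nonzero as a function, not only as a pair: if the first component
    -- vanishes, the equation tested with `z` itself gives `z = 0`.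
    · have h1 : embL2 Ω z = 0 := (Lp.eq_zero_iff_ae_eq_zero).2 h0
      have h2 := hz z
      rw [h1, inner_zero_left, mul_zero] at h2
      exact inner_self_eq_zero.1 h2
    · have h1 : pairForm k (z : L2Pair Ω) hv.1.toPair = 0 :=
        sub_eq_zero.2 (hz ⟨hv.1.toPair, hv.toPair_mem⟩)
      rw [← toPair_memH10_of_mem hΩ z.2, ← helmholtzForm_eq_pairForm] at h1
      exact sub_eq_zero.1 h1
  obtain ⟨C, hC, h⟩ := exists_norm_le_adjoint_of_isCompactOperator (isCompactOperator_embL2 hb)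
    (by positivity) h0
  exact ⟨C, hC, fun z F hF => h z F fun w => hF w w.2⟩

end Variational

/-! ### Asymptotics on shrinking balls. -/

section Localization

variable {n : ℕ} {Ω : Set (E n)}

/-- Lebesgue differentiation of the extension of `p` by zero. It concerns closed balls, but spheres
are null, and small balls around a point of `Ω` do not see the extension. -/
theorem ae_isLebesguePoint (hΩ : IsOpen Ω) {p : E n → ℝ} (hp : Integrable p (vol Ω)) :
    ∀ᵐ x ∂(vol Ω), IsLebesguePoint p x := by
  rw [ae_restrict_iff' hΩ.measurableSet]
  have hi : Integrable (Ω.indicator p) := (integrable_indicator_iff hΩ.measurableSet).2 hp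
  filter_upwards [(Besicovitch.vitaliFamily volume).ae_tendsto_average_norm_sub
    hi.locallyIntegrable] with x hx hxΩ
  have h := hx.comp (Besicovitch.tendsto_filterAt volume x)
  refine h.congr' ?_
  obtain ⟨R, hR, hRΩ⟩ := Metric.isOpen_iff.1 hΩ x hxΩ
  filter_upwards [Ioo_mem_nhdsGT hR] with r hr
  have hae : (ball x r : Set (E n)) =ᵐ[volume] closedBall x r := by
    refine (ae_eq_set).2 ⟨by simp [Set.sdiff_eq_empty.2 ball_subset_closedBall], ?_⟩
    rw [closedBall_sdiff_ball, Measure.addHaar_sphere_of_ne_zero _ _ hr.1.ne']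
  simp only [Function.comp_apply]
  rw [← setAverage_congr hae]
  simp only [setAverage_eq]
  congr 1
  refine setIntegral_congr_fun measurableSet_ball fun y hy => ?_
  simp [hRΩ (ball_subset_ball hr.2.le hy), hxΩ]

theorem volume_real_ball_pos (x : E n) {r : ℝ} (hr : 0 < r) : 0 < volume.real (ball x r) :=
  ENNReal.toReal_pos (measure_ball_pos volume x hr).ne' measure_ball_lt_top.ne

/-- The volume scales like `r ^ n`. For `n = 0` every ball is a point of measure one, so `1 ≤ n`
matters. -/
theorem tendsto_volume_ball (hn : 1 ≤ n) (x : E n) :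
    Tendsto (fun r => volume (ball x r)) (𝓝[>] 0) (𝓝 0) := by
  have h : ∀ r ∈ Set.Ioi (0 : ℝ), ENNReal.ofReal (r ^ n) * volume (ball (0 : E n) 1) =
      volume (ball x r) := fun r hr => by
    rw [Measure.addHaar_ball_of_pos _ _ hr, finrank_euclideanSpace_fin]
  refine Tendsto.congr' (eventually_nhdsWithin_of_forall h) ?_
  have h1 : Tendsto (fun r : ℝ => ENNReal.ofReal (r ^ n)) (𝓝[>] 0) (𝓝 0) := by
    have : Tendsto (fun r : ℝ => ENNReal.ofReal (r ^ n)) (𝓝 0) (𝓝 (ENNReal.ofReal (0 ^ n))) :=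
      (ENNReal.continuous_ofReal.comp (continuous_pow n)).tendsto 0
    rw [zero_pow (by omega), ENNReal.ofReal_zero] at this
    exact this.mono_left nhdsWithin_le_nhds
  simpa using ENNReal.Tendsto.mul_const h1 (Or.inr measure_ball_lt_top.ne)

theorem eventually_forall_mem_ball {P : E n → Prop} {x₀ : E n} (h : ∀ᶠ x in 𝓝 x₀, P x) :
    ∀ᶠ ε in 𝓝[>] (0 : ℝ), ∀ x ∈ ball x₀ ε, P x := by
  obtain ⟨R, hR, hRP⟩ := Metric.eventually_nhds_iff_ball.1 h
  filter_upwards [Ioo_mem_nhdsGT hR] with r hr x hx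
  exact hRP x (ball_subset_ball hr.2.le hx)

/-- Localization of the product of a continuous function and a function with Lebesgue point. -/
theorem setIntegral_ball_mul_sub_isLittleO (hΩ : IsOpen Ω) [IsFiniteMeasure (vol Ω)]
    {f p : E n → ℝ} (hf : ContinuousOn f Ω) (hf2 : MemLp f 2 (vol Ω)) (hp : MemLp p 2 (vol Ω))
    {x₀ : E n} (hx₀ : x₀ ∈ Ω) (hL : IsLebesguePoint p x₀) :
    (fun ε => (∫ x in ball x₀ ε, f x * p x) - volume.real (ball x₀ ε) * (f x₀ * p x₀))
      =o[𝓝[>] 0] fun ε => volume.real (ball x₀ ε) := by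
  rw [Asymptotics.isLittleO_iff]
  intro c hc
  -- From `f p - f(x₀) p(x₀) = f (p - p(x₀)) + (f - f(x₀)) p(x₀)` the mean error is at most `K δ`;
  -- the cap `δ ≤ 1` yields `|f| ≤ |f x₀| + 1` on the ball.
  set K := |f x₀| + 1 + |p x₀|
  have hK : 0 < K := by positivity
  set δ := min 1 (c / K) with hδ
  have hδ0 : 0 < δ := by positivity
  have hfc : ∀ᶠ x in 𝓝 x₀, |f x - f x₀| < δ := by
    have := Metric.tendsto_nhds.1 (hf.continuousAt (hΩ.mem_nhds hx₀)) δ hδ0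
    simpa only [Real.dist_eq] using this
  filter_upwards [eventually_forall_mem_ball hfc, eventually_forall_mem_ball (hΩ.mem_nhds hx₀),
    hL.eventually_lt_const hδ0, self_mem_nhdsWithin] with ε h1 h2 h3 hε
  have hm := volume_real_ball_pos x₀ hε
  set m := volume.real (ball x₀ ε)
  have hsub : volume.restrict (ball x₀ ε) ≤ vol Ω := Measure.restrict_mono_set _ h2
  have ip : IntegrableOn p (ball x₀ ε) := (hp.integrable (by norm_num)).mono_measure hsub
  have ic (a : ℝ) : IntegrableOn (fun _ : E n => a) (ball x₀ ε) :=
    integrableOn_const measure_ball_lt_top.ne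
  have ifp : IntegrableOn (fun x => f x * p x) (ball x₀ ε) :=
    (hf2.integrable_mul hp).mono_measure hsub
  have iabs : IntegrableOn (fun x => |p x - p x₀|) (ball x₀ ε) := (ip.sub (ic _)).abs
  have h4 : ∫ x in ball x₀ ε, |p x - p x₀| ≤ δ * m := by
    rw [setAverage_eq, smul_eq_mul, inv_mul_lt_iff₀ hm] at h3
    linarith
  have h5 : (∫ x in ball x₀ ε, f x * p x) - m * (f x₀ * p x₀) =
      ∫ x in ball x₀ ε, (f x * p x - f x₀ * p x₀) := by
    rw [integral_sub ifp (ic _), setIntegral_const, smul_eq_mul]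
  rw [h5, Real.norm_of_nonneg hm.le]
  calc ‖∫ x in ball x₀ ε, (f x * p x - f x₀ * p x₀)‖
      ≤ ∫ x in ball x₀ ε, ((|f x₀| + 1) * |p x - p x₀| + δ * |p x₀|) := by
        refine norm_integral_le_of_norm_le ((iabs.const_mul _).add (ic _))
          (ae_restrict_of_forall_mem measurableSet_ball fun x hx => ?_)
        have e : f x * p x - f x₀ * p x₀ = f x * (p x - p x₀) + (f x - f x₀) * p x₀ := by ring
        rw [e, Real.norm_eq_abs]
        refine (abs_add_le _ _).trans ?_
        rw [abs_mul, abs_mul]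
        have hfx : |f x| ≤ |f x₀| + 1 := by
          have := abs_add_le (f x - f x₀) (f x₀)
          rw [sub_add_cancel] at this
          linarith [h1 x hx, min_le_left 1 (c / K)]
        have := (h1 x hx).le
        gcongr
    _ = (|f x₀| + 1) * (∫ x in ball x₀ ε, |p x - p x₀|) + m * (δ * |p x₀|) := by
        rw [integral_add (iabs.const_mul _) (ic _), integral_const_mul, setIntegral_const,
          smul_eq_mul]
    _ ≤ (|f x₀| + 1) * (δ * m) + m * (δ * |p x₀|) := by gcongr
    _ = K * δ * m := by ring
    _ ≤ c * m := by
        gcongr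
        rw [mul_comm, ← le_div_iff₀ hK]
        exact min_le_right _ _

theorem memLp_perturbedSource {f : E n → ℝ} (hf : MemLp f 2 (vol Ω)) (γ : ℝ) (x₀ : E n) (ε : ℝ) :
    MemLp (perturbedSource f γ x₀ ε) 2 (vol Ω) := by
  classical
  convert! MemLp.piecewise (s := ball x₀ ε) measurableSet_ball ((hf.const_mul γ).restrict _)
    (hf.restrict _)

/-- The perturbation of the source, as an element of `L²(Ω)`. -/
noncomputable def sourceIncrement {f : E n → ℝ} (hf : MemLp f 2 (vol Ω)) (γ : ℝ) (x₀ : E n)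
    (ε : ℝ) : Lp ℝ 2 (vol Ω) :=
  (memLp_perturbedSource hf γ x₀ ε).toLp _ - hf.toLp f

theorem coeFn_sourceIncrement {f : E n → ℝ} (hf : MemLp f 2 (vol Ω)) (γ : ℝ) (x₀ : E n) (ε : ℝ) :
    sourceIncrement hf γ x₀ ε =ᵐ[vol Ω] (ball x₀ ε).indicator fun x => (γ - 1) * f x := by
  filter_upwards [Lp.coeFn_sub ((memLp_perturbedSource hf γ x₀ ε).toLp _) (hf.toLp f),
    (memLp_perturbedSource hf γ x₀ ε).coeFn_toLp, hf.coeFn_toLp] with x h1 h2 h3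
  rw [sourceIncrement, h1, Pi.sub_apply, h2, h3]
  by_cases hx : x ∈ ball x₀ ε
  · rw [perturbedSource, if_pos hx, Set.indicator_of_mem hx]; ring
  · rw [perturbedSource, if_neg hx, Set.indicator_of_notMem hx, sub_self]

theorem inner_sourceIncrement {f v : E n → ℝ} (hf : MemLp f 2 (vol Ω)) (hv : MemLp v 2 (vol Ω))
    (γ : ℝ) {x₀ : E n} {ε : ℝ} (hε : ball x₀ ε ⊆ Ω) :
    inner ℝ (sourceIncrement hf γ x₀ ε) (hv.toLp v) = (γ - 1) * ∫ x in ball x₀ ε, f x * v x := by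
  rw [L2.inner_def]
  have : ∫ x in Ω, inner ℝ (sourceIncrement hf γ x₀ ε x) (hv.toLp v x) =
      ∫ x in Ω, (ball x₀ ε).indicator (fun x => (γ - 1) * (f x * v x)) x := by
    refine integral_congr_ae ?_
    filter_upwards [coeFn_sourceIncrement hf γ x₀ ε, hv.coeFn_toLp] with x h1 h2
    rw [h1, h2, Real.inner_apply]
    by_cases hx : x ∈ ball x₀ ε <;> simp [hx, mul_assoc]
  rw [this, integral_indicator measurableSet_ball, Measure.restrict_restrict measurableSet_ball,
    Set.inter_eq_left.2 hε, integral_const_mul]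

/-- By continuity, `f` is bounded by `|f x₀| + 1` on small balls around `x₀`. -/
theorem eventually_norm_sourceIncrement_le (hΩ : IsOpen Ω) {f : E n → ℝ} (hfc : ContinuousOn f Ω)
    (hf : MemLp f 2 (vol Ω)) (γ : ℝ) {x₀ : E n} (hx₀ : x₀ ∈ Ω) :
    ∀ᶠ ε in 𝓝[>] (0 : ℝ), ‖sourceIncrement hf γ x₀ ε‖ ≤
      |γ - 1| * (|f x₀| + 1) * √(volume.real (ball x₀ ε)) := by
  have hfx : ∀ᶠ x in 𝓝 x₀, |f x| < |f x₀| + 1 :=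
    (hfc.continuousAt (hΩ.mem_nhds hx₀)).abs.eventually_lt_const (by linarith)
  filter_upwards [eventually_forall_mem_ball hfx, eventually_forall_mem_ball (hΩ.mem_nhds hx₀)]
    with ε h1 h2
  set M := |γ - 1| * (|f x₀| + 1)
  have hM : 0 ≤ M := by positivity
  refine (sq_le_sq₀ (norm_nonneg _) (by positivity)).1 ?_
  rw [norm_sq_eq_integral_of_ae_eq (coeFn_sourceIncrement hf γ x₀ ε), mul_pow,
    Real.sq_sqrt measureReal_nonneg]
  have e : ∫ x in Ω, ‖(ball x₀ ε).indicator (fun x => (γ - 1) * f x) x‖ ^ 2 =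
      ∫ x in ball x₀ ε, ‖(γ - 1) * f x‖ ^ 2 := by
    rw [← Set.inter_eq_left.2 h2, ← Measure.restrict_restrict measurableSet_ball,
      ← integral_indicator measurableSet_ball, Set.inter_eq_left.2 h2]
    congr 1 with x
    by_cases hx : x ∈ ball x₀ ε <;> simp [hx]
  rw [e]
  refine (Real.le_norm_self _).trans
    (norm_setIntegral_le_of_norm_le_const measure_ball_lt_top fun x hx => ?_)
  rw [norm_pow, norm_norm, norm_mul, Real.norm_eq_abs, Real.norm_eq_abs]
  have h3 : |γ - 1| * |f x| ≤ M := mul_le_mul_of_nonneg_left (h1 x hx).le (abs_nonneg _)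
  gcongr

/-- The pairing sees only the restriction of `y` to the ball, whose `L²` norm tends to zero by
absolute continuity of the integral, while the normalised increments stay bounded. -/
theorem tendsto_inner_sourceIncrement (hn : 1 ≤ n) (hΩ : IsOpen Ω) {f : E n → ℝ}
    (hfc : ContinuousOn f Ω) (hf : MemLp f 2 (vol Ω)) (γ : ℝ) {x₀ : E n} (hx₀ : x₀ ∈ Ω)
    (y : Lp ℝ 2 (vol Ω)) :
    Tendsto (fun ε => inner ℝ ((√(volume.real (ball x₀ ε)))⁻¹ • sourceIncrement hf γ x₀ ε) y)
      (𝓝[>] 0) (𝓝 0) := by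
  have hy := Lp.memLp y
  have hyb (ε : ℝ) : MemLp ((ball x₀ ε).indicator y) 2 (vol Ω) := hy.indicator measurableSet_ball
  have hyn (ε : ℝ) : ‖(hyb ε).toLp _‖ ^ 2 = ∫ x in ball x₀ ε, y x ^ 2 ∂(vol Ω) := by
    rw [norm_sq_eq_integral_of_ae_eq (hyb ε).coeFn_toLp, ← integral_indicator measurableSet_ball]
    congr 1 with x
    by_cases hx : x ∈ ball x₀ ε <;> simp [hx]
  have hμ : Tendsto (vol Ω ∘ fun ε => ball x₀ ε) (𝓝[>] 0) (𝓝 0) :=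
    tendsto_of_tendsto_of_tendsto_of_le_of_le tendsto_const_nhds (tendsto_volume_ball hn x₀)
      (fun _ => zero_le) fun _ => Measure.restrict_apply_le _ _
  have hlim : Tendsto (fun ε => ‖(hyb ε).toLp _‖) (𝓝[>] 0) (𝓝 0) := by
    have h1 := (hy.integrable_sq.tendsto_setIntegral_nhds_zero hμ).sqrt
    rw [Real.sqrt_zero] at h1
    refine h1.congr fun ε => ?_
    rw [← hyn, Real.sqrt_sq (norm_nonneg _)]
  set M := |γ - 1| * (|f x₀| + 1)
  have hlim2 := hlim.const_mul M
  rw [mul_zero] at hlim2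
  refine squeeze_zero_norm' ?_ hlim2
  filter_upwards [eventually_norm_sourceIncrement_le hΩ hfc hf γ hx₀, self_mem_nhdsWithin]
    with ε h1 hε
  have hm := Real.sqrt_pos.2 (volume_real_ball_pos x₀ hε)
  have e : inner ℝ (sourceIncrement hf γ x₀ ε) y =
      inner ℝ (sourceIncrement hf γ x₀ ε) ((hyb ε).toLp _) := by
    rw [L2.inner_def, L2.inner_def]
    refine integral_congr_ae ?_
    filter_upwards [coeFn_sourceIncrement hf γ x₀ ε, (hyb ε).coeFn_toLp] with x h1 h2
    rw [h1, h2]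
    by_cases hx : x ∈ ball x₀ ε <;> simp [hx]
  rw [real_inner_smul_left, e, norm_mul, norm_inv, Real.norm_of_nonneg hm.le,
    inv_mul_le_iff₀ hm]
  calc ‖inner ℝ (sourceIncrement hf γ x₀ ε) ((hyb ε).toLp _)‖
      ≤ ‖sourceIncrement hf γ x₀ ε‖ * ‖(hyb ε).toLp _‖ := norm_inner_le_norm _ _
    _ ≤ M * √(volume.real (ball x₀ ε)) * ‖(hyb ε).toLp _‖ := by gcongr
    _ = _ := by ring

/-- The dual norm of the perturbation of the source is `o(|ω|^{1/2})`. -/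
theorem adjoint_sourceIncrement_sq_isLittleO (hn : 1 ≤ n) (hΩ : IsOpen Ω)
    (hb : Bornology.IsBounded Ω) {f : E n → ℝ} (hfc : ContinuousOn f Ω)
    (hf : MemLp f 2 (vol Ω)) (γ : ℝ) {x₀ : E n} (hx₀ : x₀ ∈ Ω) :
    (fun ε => ‖(embL2 Ω).adjoint (sourceIncrement hf γ x₀ ε)‖ ^ 2)
      =o[𝓝[>] 0] fun ε => volume.real (ball x₀ ε) := by
  refine norm_adjoint_sq_isLittleO_of_isCompactOperator (isCompactOperator_embL2 hb) ?_
    (eventually_norm_sourceIncrement_le hΩ hfc hf γ hx₀)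
    (tendsto_inner_sourceIncrement hn hΩ hfc hf γ hx₀)
  filter_upwards [self_mem_nhdsWithin] with ε hε
  exact volume_real_ball_pos x₀ hε

/-- The exact expansion of the tracking functional, up to the squared norm of the increment of
the state. -/
theorem trackingFunctional_sub_eq (hΩ : IsOpen Ω) [IsFiniteMeasure (vol Ω)] {k : ℝ}
    {f : E n → ℝ} (hf : MemLp f 2 (vol Ω))
    {A : E n → E n} (hA : MemLp A 2 (vol Ω)) {η₀ : E n → ℝ} (hη₀ : MemLp η₀ 2 (vol Ω))
    {γ : ℝ} {η p : E n → ℝ} (hη : IsHelmholtzSolution Ω k f η)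
    (hp : IsAdjointState Ω k A η₀ η p) {x₀ : E n} {ε : ℝ} (hε : ball x₀ ε ⊆ Ω) {ηε : E n → ℝ}
    (hηε : IsHelmholtzSolution Ω k (perturbedSource f γ x₀ ε) ηε) :
    ∃ z : H10 Ω, (∀ w ∈ H10 Ω, pairForm k z w = inner ℝ (sourceIncrement hf γ x₀ ε) w.fst) ∧
      trackingFunctional Ω A η₀ ηε - trackingFunctional Ω A η₀ η =
        ‖z‖ ^ 2 + (1 - γ) * ∫ x in ball x₀ ε, f x * p x := by
  set N := hη.1.1.toPair
  set Nε := hηε.1.1.toPair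
  set D := trackingData hA hη₀
  have hz : Nε - N ∈ H10 Ω := (H10 Ω).sub_mem hηε.1.toPair_mem hη.1.toPair_mem
  have hform : ∀ w ∈ H10 Ω,
      pairForm k (Nε - N) w = inner ℝ (sourceIncrement hf γ x₀ ε) w.fst := by
    intro w hw
    have h1 := hηε.pairForm_eq hΩ (memLp_perturbedSource hf γ x₀ ε) hw
    have h2 := hη.pairForm_eq hΩ hf hw
    rw [sourceIncrement, inner_sub_left, ← h1, ← h2]
    simp only [pairForm, WithLp.sub_fst, inner_sub_left]
    ring
  refine ⟨⟨Nε - N, hz⟩, hform, ?_⟩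
  -- The adjoint equation tested with the state increment and the increment equation tested with `p`
  -- share their left side. This evaluates the cross term of the square as `(1 - γ) ∫ f p`.
  have h3 := hp.pairForm_eq hΩ hA hη₀ hη.1.1 hz
  rw [hform _ hp.1.toPair_mem] at h3
  change inner ℝ _ (hp.1.1.1.toLp p) = _ at h3
  rw [inner_sourceIncrement hf hp.1.1.1 γ hε] at h3
  rw [trackingFunctional_eq_norm_sq hA hη₀ hηε.1.1, trackingFunctional_eq_norm_sq hA hη₀ hη.1.1]
  change ‖Nε - D‖ ^ 2 - ‖N - D‖ ^ 2 = ‖Nε - N‖ ^ 2 + _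
  have h4 : Nε - D = (N - D) + (Nε - N) := by abel
  rw [h4, norm_add_sq_real]
  linarith

end Localization

end HelmholtzTopDeriv

/-! ### The topological derivative. -/

open HelmholtzTopDeriv in
theorem mainTheorem8 (n : ℕ) (hn : 1 ≤ n)
    (Ω : Set (HelmholtzTopDeriv.E n)) (hΩ : IsOpen Ω) (hΩb : Bornology.IsBounded Ω)
    (k : ℝ) (hk : ¬ HelmholtzTopDeriv.IsDirichletEigenvalue Ω (k ^ 2))
    (f : HelmholtzTopDeriv.E n → ℝ) (hf : ContinuousOn f Ω)
    (hf2 : MemLp f 2 (volume.restrict Ω))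
    (A : HelmholtzTopDeriv.E n → HelmholtzTopDeriv.E n) (hA : MemLp A 2 (volume.restrict Ω))
    (η₀ : HelmholtzTopDeriv.E n → ℝ) (hη₀ : MemLp η₀ 2 (volume.restrict Ω))
    (γ : ℝ) (hγ : 0 < γ)
    (η : HelmholtzTopDeriv.E n → ℝ) (hη : HelmholtzTopDeriv.IsHelmholtzSolution Ω k f η)
    (p : HelmholtzTopDeriv.E n → ℝ) (hp : HelmholtzTopDeriv.IsAdjointState Ω k A η₀ η p) :
    (∀ᵐ x₀ ∂(volume.restrict Ω), HelmholtzTopDeriv.IsLebesguePoint p x₀) ∧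
    ∀ x₀ ∈ Ω, HelmholtzTopDeriv.IsLebesguePoint p x₀ →
      ∀ ηε : ℝ → HelmholtzTopDeriv.E n → ℝ,
        (∀ᶠ ε in 𝓝[>] (0 : ℝ), HelmholtzTopDeriv.IsHelmholtzSolution Ω k
          (HelmholtzTopDeriv.perturbedSource f γ x₀ ε) (ηε ε)) →
        HelmholtzTopDeriv.HasTopologicalDerivative
          (fun ε => HelmholtzTopDeriv.trackingFunctional Ω A η₀ (ηε ε))
          (HelmholtzTopDeriv.trackingFunctional Ω A η₀ η)
          (fun ε => volume.real (ball x₀ ε))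
          ((1 - γ) * f x₀ * p x₀) := by
  have hfin : IsFiniteMeasure (vol Ω) := ⟨by simpa using hΩb.measure_lt_top⟩
  have hp2 : MemLp p 2 (vol Ω) := hp.1.1.1
  refine ⟨ae_isLebesguePoint hΩ (hp2.integrable (by norm_num)), ?_⟩
  intro x₀ hx₀ hL ηε hηε
  refine ⟨?_, ?_, ?_⟩
  · filter_upwards [self_mem_nhdsWithin] with ε hε
    exact volume_real_ball_pos x₀ hε
  · exact (ENNReal.tendsto_toReal ENNReal.zero_ne_top).comp (tendsto_volume_ball hn x₀)
  obtain ⟨C, -, hstab⟩ := exists_norm_le_adjoint_embL2 hΩ hΩb hk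
  obtain ⟨a, ha⟩ : ∃ a : ℝ → ℝ, ∀ ε, ‖(embL2 Ω).adjoint (sourceIncrement hf2 γ x₀ ε)‖ = a ε :=
    ⟨_, fun _ => rfl⟩
  have h0 := adjoint_sourceIncrement_sq_isLittleO hn hΩ hΩb hf hf2 γ hx₀
  simp only [ha] at h0
  have h1 := h0.const_mul_left (C ^ 2)
  have h2 := (setIntegral_ball_mul_sub_isLittleO hΩ hf hf2 hp2 hx₀ hL).const_mul_left (1 - γ)
  -- This difference is exactly the squared norm of the state increment, which stability bounds by
  -- the dual norm of the source perturbation.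
  have h3 : (fun ε => trackingFunctional Ω A η₀ (ηε ε) - trackingFunctional Ω A η₀ η -
      (1 - γ) * ∫ x in ball x₀ ε, f x * p x) =O[𝓝[>] 0] fun ε => C ^ 2 * a ε ^ 2 := by
    refine Asymptotics.IsBigO.of_bound 1 ?_
    filter_upwards [hηε, eventually_forall_mem_ball (hΩ.mem_nhds hx₀)] with ε hε hball
    obtain ⟨z, hz, he⟩ := trackingFunctional_sub_eq hΩ hf2 hA hη₀ hη hp hball hε
    have hza := hstab z _ hz
    rw [ha] at hza
    have hb := norm_nonneg z
    generalize ‖z‖ = b at hza he hb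
    rw [he, add_sub_cancel_right, one_mul, ← mul_pow, Real.norm_of_nonneg (sq_nonneg b),
      Real.norm_of_nonneg (sq_nonneg _)]
    exact pow_le_pow_left₀ hb hza 2
  refine ((h3.trans_isLittleO h1).add h2).congr_left fun ε => ?_
  ring
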